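/- Let $k$ be an algebraically closed field of characteristic zero and let $L$ be a nilpotent Lie algebra over $k$ of finite dimension $n$. For $\xi\in L^*$ put $L(\xi)=\{x\in L:\xi([x,y])=0\text{ for all }y\in L\}$. Let $i(L)=\min_{\xi\in L^*}\dim L(\xi)$ be the index of $L$, call $\xi$ regular if $\dim L(\xi)=i(L)$, and let $L^*_{\rm sing}$ be the set of $\xi\in L^*$ that are not regular. Call $L$ singular if $L^*_{\rm sing}$ has codimension one in $L^*$, and nonsingular otherwise. Put $c(L)=\tfrac12(\dim L+i(L))$, let $\alpha(L)$ be the maximal dimension of an abelian subalgebra of $L$, and let $F(L)=\sum_{\xi\text{ regular}}L(\xi)$. Call $L$ quasi quadratic if $F(L)=L$. A commutative polarization (CP) of $L$ is an abelian subalgebra of dimension $c(L)$. The algebra $L$ has the R-property if it has a CP or an abelian subalgebra of dimension $c(L)-1$. (1) If $n\le 7$, then $L$ has the R-property. More precisely: (a) if $F(L)$ is abelian, then $\alpha(L)=c(L)$; if in addition $L$ is nonsingular, then $F(L)$ is a CP of $L$, and it is the only one; (b) if $F(L)$ is not abelian, then $\alpha(L)=c(L)-1$. (2) If $n=8$, then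 $L$ has the R-property if one of the following holds: (i) $i(L)\ne4$; (ii) $i(L)=4$ and $L$ is not quasi quadratic. -/

import Mathlib

noncomputable section

namespace RentschlerProperty

variable (k : Type*) (L : Type*) [Field k] [LieRing L] [LieAlgebra k L]

variable {k L} in
/-- The stabilizer `L(ξ) = {x ∈ L | ξ([x,y]) = 0 for all y ∈ L}` of a linear functional. -/
def stabilizer (ξ : Module.Dual k L) : Submodule k L where
  carrier := {x | ∀ y : L, ξ ⁅x, y⁆ = 0}
  add_mem' := by
    intro a b ha hb y
    rw [add_lie, map_add, ha y, hb y, add_zero]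
  zero_mem' := by
    intro y
    rw [zero_lie, map_zero]
  smul_mem' := by
    intro c x hx y
    rw [smul_lie, map_smul, hx y, smul_zero]

/-- The index `i(L)`: the minimal value of `dim L(ξ)`. -/
def index : ℕ := ⨅ ξ : Module.Dual k L, Module.finrank k (stabilizer ξ)

/-- The set of regular linear functionals. -/
def regularSet : Set (Module.Dual k L) :=
  {ξ | Module.finrank k (stabilizer ξ) = index k L}

/-- The magic number `c(L) = (dim L + i(L)) / 2`, as a rational number. It is in fact
an integer, since `dim L - i(L)` is even. -/
def magicNumber : ℚ := ((Module.finrank k L : ℚ) + (index k L : ℚ)) / 2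

/-- The maximal dimension `α(L)` of an abelian subalgebra (for `L` finite dimensional, so that
the set of these dimensions is bounded; it contains `0`). -/
def maxAbelianDim : ℕ :=
  sSup {d : ℕ | ∃ A : LieSubalgebra k L, IsLieAbelian A ∧ Module.finrank k A = d}

/-- The Frobenius semiradical `F(L)`: the sum of the stabilizers of the regular functionals. -/
def frobeniusSemiradical : Submodule k L :=
  ⨆ ξ ∈ regularSet k L, stabilizer ξ

/-- `F(L)` is abelian. -/
def SemiradicalAbelian : Prop :=
  ∀ x ∈ frobeniusSemiradical k L, ∀ y ∈ frobeniusSemiradical k L, ⁅x, y⁆ = 0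

/-- `L` is quasi quadratic: `F(L) = L`. -/
def QuasiQuadratic : Prop := frobeniusSemiradical k L = ⊤

variable {k L} in
/-- A commutative polarization (CP): an abelian subalgebra of dimension `c(L)`. -/
def IsCP (P : LieSubalgebra k L) : Prop :=
  IsLieAbelian P ∧ (Module.finrank k P : ℚ) = magicNumber k L

/-- Rentschler's property: `L` admits a CP or an abelian subalgebra of dimension `c(L) - 1`. -/
def RProperty : Prop :=
  (∃ P : LieSubalgebra k L, IsCP P) ∨
    ∃ H : LieSubalgebra k L, IsLieAbelian H ∧
      (Module.finrank k H : ℚ) = magicNumber k L - 1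

variable {k L} in
/-- The ideal of the polynomial functions on `L*` that vanish on `S`. An element of the symmetric
algebra of `L` is a polynomial function on `L*`; its value at `ξ` is its image under the
algebra homomorphism to `k` that extends `ξ`. -/
def vanishingIdeal (S : Set (Module.Dual k L)) : Ideal (SymmetricAlgebra k L) :=
  ⨅ ξ ∈ S, RingHom.ker (SymmetricAlgebra.lift (A := k) ξ)

variable {k L} in
/-- The codimension in `L*` of (the Zariski closure of) `S`: the height of its vanishing ideal,
that is, the smallest codimension of an irreducible component; it is `⊤` for the empty set. -/
def codim (S : Set (Module.Dual k L)) : ℕ∞ := (vanishingIdeal S).height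

/-- `L` is singular if the set of nonregular functionals has codimension one in `L*`. -/
def IsSingular : Prop := codim (regularSet k L)ᶜ = 1

/-- `L` is nonsingular if it is not singular. -/
def IsNonsingular : Prop := ¬ IsSingular k L

end RentschlerProperty

end

/-! Write B_ξ for the alternating form ξ[x,y] on L. Its radical is L(ξ), and its maximal rank is n -
i(L) = 2r. A commutative subspace A is isotropic for every B_ξ, so dim A ≤ c(L). In the case of
equality A contains L(ξ) for every regular ξ, hence F(L) ≤ A. So a CP forces F(L) to be abelian,
which is the upper bound in (b). What remains is to construct large commutative subspaces.

Two sources supply them. A maximal commutative ideal of a nilpotent L is its own centralizer, so L/A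
embeds into strictly triangular matrices on A and n ≤ a + a(a-1)/2 with a = dim A
(`exists_commutative_finrank_le`). This gives a ≥ 3 for n ≥ 4 and a ≥ 4 for n ≥ 7. The other source
is the classification of spaces of alternating forms of rank at most two
(`commutative_or_central_of_pfaffian`): such a space on V has a common isotropic hyperplane or a
common radical Z of codimension three. It applies to V = L if r ≤ 1. If r = 2 it applies to a
hyperplane that contains F(L), where the rank drops. This settles n = 8, i = 4.

For (a) one more dimension is needed. In the codimension three case without a commutative hyperplane
("free mod Z"), V/Z has independent brackets. If the kernels of the B_ξ on V lift to stabilizers,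
F(L) is not commutative (`semiradical_not_commutative`). Otherwise Z is central in L, and a
commutative subspace of codimension two is found by hand (`exists_commutative_of_hyperplane`).

Uniqueness is separate: if F(L) is smaller than a CP, a polynomial relation between the columns of
the bracket matrix produces a hypersurface of nonregular functionals
(`semiradical_eq_of_isNonsingular`). -/

open Module

namespace RentschlerProperty

/-! ### The forms B_ξ, their radicals and isotropic subspaces. -/

section Stabilizers

variable {k L : Type*} [Field k] [LieRing L] [LieAlgebra k L]

lemma mem_stabilizer {ξ : Dual k L} {x : L} :
    x ∈ stabilizer ξ ↔ ∀ y : L, ξ ⁅x, y⁆ = 0 := Iff.rfl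

lemma dual_lie_skew (ξ : Dual k L) (x y : L) : ξ ⁅x, y⁆ = -ξ ⁅y, x⁆ := by
  rw [← lie_skew, map_neg]

/-- The alternating form `(x, y) ↦ ξ ⁅x, y⁆`. -/
def kirillovForm (ξ : Dual k L) : LinearMap.BilinForm k L :=
  LinearMap.mk₂ k (fun x y => ξ ⁅x, y⁆) (by simp) (by simp) (by simp) (by simp)

@[simp] lemma kirillovForm_apply (ξ : Dual k L) (x y : L) : kirillovForm ξ x y = ξ ⁅x, y⁆ := rfl

lemma kirillovForm_isRefl (ξ : Dual k L) : (kirillovForm ξ).IsRefl := by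
  intro x y h
  rw [kirillovForm_apply] at h ⊢
  rw [dual_lie_skew, h, neg_zero]

lemma kirillovForm_orthogonal_top (ξ : Dual k L) :
    (kirillovForm ξ).orthogonal ⊤ = stabilizer ξ := by
  ext x
  simp only [LinearMap.BilinForm.mem_orthogonal_iff, Submodule.mem_top, forall_const,
    mem_stabilizer, kirillovForm_apply]
  exact ⟨fun h y => by rw [dual_lie_skew, h y, neg_zero],
    fun h y => by rw [dual_lie_skew, h y, neg_zero]⟩

lemma mem_stabilizer_of_forall_lie {x : L} (h : ∀ y : L, ⁅x, y⁆ = 0) (ξ : Dual k L) :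
    x ∈ stabilizer ξ := fun y => by rw [h y, map_zero]

variable (k L) in
lemma regularSet_nonempty : (regularSet k L).Nonempty := by
  obtain ⟨ξ, hξ⟩ := Nat.sInf_mem
    (Set.range_nonempty fun ξ : Dual k L => finrank k (stabilizer ξ))
  exact ⟨ξ, hξ⟩

lemma index_le (ξ : Dual k L) : index k L ≤ finrank k (stabilizer ξ) :=
  Nat.sInf_le ⟨ξ, rfl⟩

lemma stabilizer_le_semiradical {ξ : Dual k L} (hξ : ξ ∈ regularSet k L) :
    stabilizer ξ ≤ frobeniusSemiradical k L :=
  le_iSup₂_of_le ξ hξ le_rfl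

variable [FiniteDimensional k L]

/-- A nonzero Gram determinant makes the vectors independent modulo the radical `stabilizer ξ`. The
subspace `H` is kept general because the rank of the form on a hyperplane is needed later. -/
lemma add_finrank_stabilizer_le_of_gram {m : ℕ} (ξ : Dual k L) (H : Submodule k L)
    (hH : stabilizer ξ ≤ H) (x : Fin m → L) (hx : ∀ i, x i ∈ H)
    (h : (Matrix.of fun i j => ξ ⁅x i, x j⁆).det ≠ 0) :
    m + finrank k (stabilizer ξ) ≤ finrank k H := by
  have hli : LinearIndependent k (fun i => (stabilizer ξ).mkQ (x i)) := by
    rw [Fintype.linearIndependent_iff]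
    intro g hg
    have hmem : ∑ i, g i • x i ∈ stabilizer ξ := by
      rw [← Submodule.Quotient.mk_eq_zero, ← Submodule.mkQ_apply, map_sum]
      simpa using hg
    have hv : Matrix.vecMul g (Matrix.of fun i j => ξ ⁅x i, x j⁆) = 0 := by
      ext j
      have := hmem (x j)
      rw [sum_lie] at this
      simpa [Matrix.vecMul, dotProduct] using this
    exact fun i => congrFun (Matrix.eq_zero_of_vecMul_eq_zero h hv) i
  have h1 := finrank_span_eq_card hli
  have h2 := Submodule.finrank_mono (Submodule.span_le.mpr
    (Set.range_subset_iff.mpr fun i => Submodule.mem_map_of_mem (f := (stabilizer ξ).mkQ) (hx i)))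
  have h3 := ((stabilizer ξ).mkQ.domRestrict H).finrank_range_add_finrank_ker
  rw [LinearMap.range_domRestrict, LinearMap.ker_domRestrict, Submodule.ker_mkQ,
    (Submodule.comapSubtypeEquivOfLe hH).finrank_eq] at h3
  rw [Fintype.card_fin] at h1
  omega

/-- The form is nondegenerate on any complement of its radical, so a basis of a complement serves.
-/
lemma exists_gram (ξ : Dual k L) {m : ℕ} (hm : m + finrank k (stabilizer ξ) = finrank k L) :
    ∃ x : Fin m → L, (Matrix.of fun i j => ξ ⁅x i, x j⁆).det ≠ 0 := by
  obtain ⟨C, hC⟩ := (stabilizer ξ).exists_isCompl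
  have hd := Submodule.finrank_add_eq_of_isCompl hC
  let b := finBasisOfFinrankEq k C (show finrank k C = m by omega)
  refine ⟨fun i => (b i : L), fun hdet => ?_⟩
  obtain ⟨v, hv, hv0⟩ := Matrix.exists_mulVec_eq_zero_iff.mpr hdet
  let u : C := ∑ j, v j • b j
  have hu : (u : L) ∈ stabilizer ξ := by
    have hC0 : ∀ c : C, ξ ⁅(c : L), (u : L)⁆ = 0 := by
      have : ((kirillovForm ξ).flip (u : L)) ∘ₗ C.subtype = 0 := by
        refine b.ext fun i => ?_
        have := congrFun hv0 i
        simpa [Matrix.mulVec, dotProduct, u, lie_sum, mul_comm] using this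
      intro c
      simpa using LinearMap.congr_fun this c
    intro y
    obtain ⟨s, hs, c, hc, rfl⟩ := Submodule.mem_sup.mp
      (show y ∈ stabilizer ξ ⊔ C by rw [hC.sup_eq_top]; trivial)
    rw [lie_add, map_add, dual_lie_skew ξ _ s, hs, dual_lie_skew ξ _ c, hC0 ⟨c, hc⟩]
    simp
  have hu0 : u = 0 := by
    have := (Submodule.disjoint_def.mp hC.disjoint) u hu u.2
    exact_mod_cast this
  apply hv
  ext j
  have := b.linearIndependent
  rw [Fintype.linearIndependent_iff] at this
  exact this v hu0 j

lemma even_finrank_sub_stabilizer [CharZero k] (ξ : Dual k L) {m : ℕ}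
    (hm : m + finrank k (stabilizer ξ) = finrank k L) : Even m := by
  obtain ⟨x, hx⟩ := exists_gram ξ hm
  set A : Matrix (Fin m) (Fin m) k := Matrix.of fun i j => ξ ⁅x i, x j⁆ with hA
  have hT : A.transpose = -A := by
    ext i j
    simp only [hA, Matrix.transpose_apply, Matrix.of_apply, Matrix.neg_apply]
    exact dual_lie_skew ξ _ _
  have h := A.det_transpose
  rw [hT, Matrix.det_neg, Fintype.card_fin] at h
  by_contra hodd
  rw [Nat.not_even_iff_odd] at hodd
  rw [hodd.neg_one_pow] at h
  apply hx
  have h2 : (2 : k) * A.det = 0 := by linear_combination -h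
  simpa using h2

variable (k L) in
lemma index_le_finrank : index k L ≤ finrank k L :=
  (index_le 0).trans (Submodule.finrank_le _)

variable (k L) in
lemma exists_finrank_eq_index_add [CharZero k] :
    ∃ r : ℕ, finrank k L = index k L + 2 * r := by
  obtain ⟨ξ, hξ⟩ := regularSet_nonempty k L
  have hξ : finrank k (stabilizer ξ) = index k L := hξ
  obtain ⟨r, hr⟩ := even_finrank_sub_stabilizer ξ
    (m := finrank k L - index k L) (by have := index_le_finrank k L; omega)
  exact ⟨r, by have := index_le_finrank k L; omega⟩

/-- Dimension count for `A ≤ A^⊥`, where dim A + dim A^⊥ = dim L + dim (A ∩ L(ξ)). -/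
lemma isotropic_finrank (ξ : Dual k L) (A : Submodule k L)
    (hA : ∀ x ∈ A, ∀ y ∈ A, ξ ⁅x, y⁆ = 0) :
    2 * finrank k A ≤ finrank k L + finrank k (A ⊓ stabilizer ξ : Submodule k L) := by
  have h := LinearMap.BilinForm.finrank_add_finrank_orthogonal (kirillovForm_isRefl ξ) A
  rw [kirillovForm_orthogonal_top] at h
  have hle : A ≤ (kirillovForm ξ).orthogonal A := fun x hx y hy => hA y hy x hx
  have := Submodule.finrank_mono hle
  omega

lemma isotropic_finrank_le (A : Submodule k L) (hA : ∀ x ∈ A, ∀ y ∈ A, ⁅x, y⁆ = 0) :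
    2 * finrank k A ≤ finrank k L + index k L := by
  obtain ⟨ξ, hξ⟩ := regularSet_nonempty k L
  have h := isotropic_finrank ξ A fun x hx y hy => by rw [hA x hx y hy, map_zero]
  have h2 := Submodule.finrank_mono (inf_le_right : A ⊓ stabilizer ξ ≤ stabilizer ξ)
  have hξ : finrank k (stabilizer ξ) = index k L := hξ
  omega

/-- Equality in the isotropic bound leaves no room: A ∩ L(ξ) must have the full dimension i(L) for
every regular ξ. -/
lemma semiradical_le_of_finrank (A : Submodule k L) (hA : ∀ x ∈ A, ∀ y ∈ A, ⁅x, y⁆ = 0)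
    (hd : 2 * finrank k A = finrank k L + index k L) : frobeniusSemiradical k L ≤ A := by
  refine iSup₂_le fun ξ hξ => ?_
  have h := isotropic_finrank ξ A fun x hx y hy => by rw [hA x hx y hy, map_zero]
  have hξ : finrank k (stabilizer ξ) = index k L := hξ
  have := Submodule.eq_of_le_of_finrank_le (inf_le_right : A ⊓ stabilizer ξ ≤ stabilizer ξ)
    (by omega)
  exact inf_eq_right.mp this

end Stabilizers

/-! ### The symmetric algebra as polynomial functions on L*; density of the regular functionals. -/

section PolynomialFunctions

variable {k L : Type*} [Field k] [LieRing L] [LieAlgebra k L]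

/-- The polynomial function on the dual space `L*` that is given by an element of `L`. -/
abbrev coord : L →ₗ[k] SymmetricAlgebra k L := SymmetricAlgebra.ι k L

/-- The value of a polynomial function at `ξ`. -/
abbrev evalAt (ξ : Dual k L) : SymmetricAlgebra k L →ₐ[k] k := SymmetricAlgebra.lift ξ

lemma evalAt_basis {κ : Type*} (b : Basis κ k L) (ξ : Dual k L) (f : SymmetricAlgebra k L) :
    evalAt ξ f =
      MvPolynomial.eval (fun i => ξ (b i)) (SymmetricAlgebra.equivMvPolynomial b f) := by
  have : evalAt ξ = (MvPolynomial.aeval (fun i => ξ (b i))).comp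
      (SymmetricAlgebra.equivMvPolynomial b).toAlgHom := by
    apply SymmetricAlgebra.algHom_ext
    refine b.ext fun i => ?_
    simp
  rw [this]
  simp [MvPolynomial.aeval_eq_eval]

lemma coord_ne_zero {w : L} (hw : w ≠ 0) : coord (k := k) w ≠ 0 := by
  intro h
  refine hw ((forall_dual_apply_eq_zero_iff k w).mp fun ξ => ?_)
  rw [← SymmetricAlgebra.lift_ι_apply ξ w, h, map_zero]

variable [FiniteDimensional k L]

lemma eq_zero_of_forall_evalAt [Infinite k] {f : SymmetricAlgebra k L}
    (h : ∀ ξ : Dual k L, evalAt ξ f = 0) : f = 0 := by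
  let b := finBasis k L
  rw [← (SymmetricAlgebra.equivMvPolynomial b).map_eq_zero_iff]
  refine MvPolynomial.funext fun x => ?_
  have := h (b.constr k x)
  rw [evalAt_basis b] at this
  simpa [Basis.constr_basis] using this

instance : UniqueFactorizationMonoid (SymmetricAlgebra k L) :=
  (SymmetricAlgebra.equivMvPolynomial (finBasis k L)).symm.toMulEquiv.uniqueFactorizationMonoid
    inferInstance

instance : IsNoetherianRing (SymmetricAlgebra k L) :=
  isNoetherianRing_of_ringEquiv _
    (SymmetricAlgebra.equivMvPolynomial (finBasis k L)).symm.toRingEquiv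

/-- A form of the Nullstellensatz for polynomial functions on the dual space. -/
lemma dvd_of_vanishes [IsAlgClosed k] {p f : SymmetricAlgebra k L} (hp : Prime p)
    (h : ∀ ξ : Dual k L, evalAt ξ p = 0 → evalAt ξ f = 0) : p ∣ f := by
  let b := finBasis k L
  let e := SymmetricAlgebra.equivMvPolynomial b
  have hp' : Prime (e p) := (MulEquiv.prime_iff e.toMulEquiv).mpr hp
  have hI : (Ideal.span {e p}).IsPrime := (Ideal.span_singleton_prime hp'.ne_zero).mpr hp'
  have hmem : e f ∈ (Ideal.span {e p}).radical := by
    rw [← MvPolynomial.vanishingIdeal_zeroLocus_eq_radical (K := k),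
      MvPolynomial.mem_vanishingIdeal_iff]
    intro x hx
    have hx' : MvPolynomial.aeval x (e p) = 0 := hx _ (Ideal.mem_span_singleton_self _)
    have := h (b.constr k x)
    rw [evalAt_basis b, evalAt_basis b] at this
    simp only [Basis.constr_basis] at this
    rw [MvPolynomial.aeval_eq_eval] at hx' ⊢
    exact this hx'
  rw [hI.radical, Ideal.mem_span_singleton] at hmem
  exact (map_dvd_iff e).mp hmem

lemma exists_evalAt_ne_zero [Infinite k] {f : SymmetricAlgebra k L} (hf : f ≠ 0) :
    ∃ ξ : Dual k L, evalAt ξ f ≠ 0 := by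
  by_contra! h
  exact hf (eq_zero_of_forall_evalAt h)

variable (k L) in
-- The polynomial is the Gram determinant of vectors on which one regular form is nondegenerate;
-- where it does not vanish, the rank is maximal.
lemma exists_generic_polynomial : ∃ f : SymmetricAlgebra k L, f ≠ 0 ∧
    ∀ ξ : Dual k L, evalAt ξ f ≠ 0 → ξ ∈ regularSet k L := by
  obtain ⟨ξ₀, h₀⟩ := regularSet_nonempty k L
  have h₀ : finrank k (stabilizer ξ₀) = index k L := h₀
  have hle := index_le_finrank k L
  obtain ⟨x, hx⟩ := exists_gram ξ₀ (m := finrank k L - index k L) (by omega)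
  have key : ∀ ξ : Dual k L, evalAt ξ (Matrix.of fun i j => coord (k := k) ⁅x i, x j⁆).det =
      (Matrix.of fun i j => ξ ⁅x i, x j⁆).det := by
    intro ξ
    rw [AlgHom.map_det]
    congr 1
    ext i j
    simp
  refine ⟨(Matrix.of fun i j => coord (k := k) ⁅x i, x j⁆).det, fun h => hx ?_, fun ξ hξ => ?_⟩
  · rw [← key, h, map_zero]
  · rw [key] at hξ
    have := add_finrank_stabilizer_le_of_gram ξ ⊤ le_top x (by simp) hξ
    rw [finrank_top] at this
    have h2 := index_le ξ
    show finrank k (stabilizer ξ) = index k L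
    omega

lemma exists_regular_ne_zero [Infinite k] {v w : L} (hv : v ≠ 0) (hw : w ≠ 0) :
    ∃ ξ ∈ regularSet k L, ξ v ≠ 0 ∧ ξ w ≠ 0 := by
  obtain ⟨f, hf, hreg⟩ := exists_generic_polynomial k L
  obtain ⟨ξ, hξ⟩ := exists_evalAt_ne_zero
    (mul_ne_zero (mul_ne_zero hf (coord_ne_zero (k := k) hv)) (coord_ne_zero (k := k) hw))
  simp only [map_mul, SymmetricAlgebra.lift_ι_apply, ne_eq, mul_eq_zero, not_or] at hξ
  exact ⟨ξ, hreg ξ hξ.1.1, hξ.1.2, hξ.2⟩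

lemma eq_zero_of_forall_regular [Infinite k] {g : SymmetricAlgebra k L}
    (h : ∀ ξ ∈ regularSet k L, evalAt ξ g = 0) : g = 0 := by
  obtain ⟨f, hf, hreg⟩ := exists_generic_polynomial k L
  have : f * g = 0 := by
    refine eq_zero_of_forall_evalAt fun ξ => ?_
    by_cases hξ : evalAt ξ f = 0
    · rw [map_mul, hξ, zero_mul]
    · rw [map_mul, h ξ (hreg ξ hξ), mul_zero]
  exact (mul_eq_zero.mp this).resolve_left hf

end PolynomialFunctions

/-! ### Pairs of linear maps with pointwise parallel values. -/

section LocallyDependent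

variable {k E N : Type*} [Field k] [AddCommGroup E] [Module k E] [AddCommGroup N] [Module k N]

lemma dual_parallel {p q : Dual k N} (h : ∀ z w, p z * q w = p w * q z) (hp : p ≠ 0) :
    ∃ c : k, q = c • p := by
  obtain ⟨z, hz⟩ : ∃ z, p z ≠ 0 := by
    by_contra! h0
    exact hp (LinearMap.ext h0)
  refine ⟨q z / p z, LinearMap.ext fun w => ?_⟩
  rw [LinearMap.smul_apply, smul_eq_mul]
  field_simp
  linear_combination h z w

/-- When T e and T e₀ are independent, comparing S = f T at e + e₀ with the ratios at e and at e₀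
shows that these agree. The remaining e, with T e on the line of T e₀, are reached by adding e₁. -/
lemma locally_dependent_of_not_parallel {T S : E →ₗ[k] Dual k N}
    (h : ∀ e z w, T e z * S e w = T e w * S e z) {e₀ e₁ : E} (h₀ : T e₀ ≠ 0)
    (h₁ : ∀ c : k, T e₁ ≠ c • T e₀) : ∃ c : k, S = c • T := by
  have hpar : ∀ e, T e ≠ 0 → ∃ c : k, S e = c • T e := fun e he => dual_parallel (h e) he
  obtain ⟨c, hc⟩ := hpar e₀ h₀
  have hout : ∀ e, (∀ d : k, T e ≠ d • T e₀) → S e = c • T e := by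
    intro e he
    obtain ⟨d, hd⟩ := hpar e (by simpa using he 0)
    obtain ⟨f, hf⟩ := hpar (e + e₀) (by
      rw [map_add]
      intro h0
      exact he (-1) (by rw [eq_neg_of_add_eq_zero_left h0]; module))
    rw [map_add, map_add, hd, hc] at hf
    have h1 : (d - f) • T e = (f - c) • T e₀ := by linear_combination (norm := module) hf
    have hdf : d = f := by
      by_contra hne
      have hne : d - f ≠ 0 := sub_ne_zero.mpr hne
      apply he ((d - f)⁻¹ * (f - c))
      rw [mul_smul, ← h1, smul_smul, inv_mul_cancel₀ hne, one_smul]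
    rw [hdf, sub_self, zero_smul, eq_comm, smul_eq_zero, sub_eq_zero] at h1
    rw [hd, hdf, h1.resolve_right h₀]
  refine ⟨c, LinearMap.ext fun e => ?_⟩
  rw [LinearMap.smul_apply]
  by_cases he : ∀ d : k, T e ≠ d • T e₀
  · exact hout e he
  · push Not at he
    obtain ⟨d, hd⟩ := he
    have h2 := hout (e + e₁) fun f hf => h₁ (f - d) (by
      rw [map_add, hd] at hf
      linear_combination (norm := module) hf)
    rw [map_add, map_add, hout e₁ h₁] at h2
    linear_combination (norm := module) h2

/-- Two linear maps to a dual space whose values at each vector are parallel are linearly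
dependent, or they have values in a common line. -/
lemma locally_dependent {T S : E →ₗ[k] Dual k N}
    (h : ∀ e z w, T e z * S e w = T e w * S e z) :
    (∃ a b : k, ¬(a = 0 ∧ b = 0) ∧ a • T + b • S = 0) ∨
      ∃ p : Dual k N, p ≠ 0 ∧ ∀ e, (∃ c : k, T e = c • p) ∧ ∃ c : k, S e = c • p := by
  by_cases hT : T = 0
  · exact Or.inl ⟨1, 0, by simp, by simp [hT]⟩
  by_cases hS : S = 0
  · exact Or.inl ⟨0, 1, by simp, by simp [hS]⟩
  obtain ⟨e₀, he₀⟩ : ∃ e, T e ≠ 0 := by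
    by_contra! h0
    exact hT (LinearMap.ext h0)
  obtain ⟨e₁, he₁⟩ : ∃ e, S e ≠ 0 := by
    by_contra! h0
    exact hS (LinearMap.ext h0)
  have h' : ∀ e z w, S e z * T e w = S e w * T e z := fun e z w => by
    linear_combination h e w z
  by_cases hT1 : ∃ e, ∀ c : k, T e ≠ c • T e₀
  · obtain ⟨e, he⟩ := hT1
    obtain ⟨c, hc⟩ := locally_dependent_of_not_parallel h he₀ he
    exact Or.inl ⟨c, -1, by simp, by rw [hc]; module⟩
  by_cases hS1 : ∃ e, ∀ c : k, S e ≠ c • S e₁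
  · obtain ⟨e, he⟩ := hS1
    obtain ⟨c, hc⟩ := locally_dependent_of_not_parallel h' he₁ he
    exact Or.inl ⟨-1, c, by simp, by rw [hc]; module⟩
  push Not at hT1 hS1
  -- Both images are now lines. They coincide because T and S are both nonzero at one of e₀, e₁, e₀
  -- + e₁.
  have hpq : ∃ c : k, S e₁ = c • T e₀ := by
    by_cases h2 : S e₀ = 0
    · by_cases h3 : T e₁ = 0
      · obtain ⟨c, hc⟩ := dual_parallel (h (e₀ + e₁)) (by rw [map_add, h3, add_zero]; exact he₀)
        exact ⟨c, by simpa [h2, h3] using hc⟩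
      · obtain ⟨c, hc⟩ := dual_parallel (h e₁) h3
        obtain ⟨d, hd⟩ := hT1 e₁
        exact ⟨c * d, by rw [hc, hd, smul_smul]⟩
    · obtain ⟨c, hc⟩ := dual_parallel (h' e₀) h2
      obtain ⟨d, hd⟩ := hS1 e₀
      rw [hd, smul_smul] at hc
      have hcd : c * d ≠ 0 := fun h0 => he₀ (by rw [hc, h0, zero_smul])
      exact ⟨(c * d)⁻¹, by rw [hc, smul_smul, inv_mul_cancel₀ hcd, one_smul]⟩
  obtain ⟨c, hc⟩ := hpq
  refine Or.inr ⟨T e₀, he₀, fun e => ⟨hT1 e, ?_⟩⟩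
  obtain ⟨d, hd⟩ := hS1 e
  exact ⟨d * c, by rw [hd, hc, smul_smul]⟩

end LocallyDependent

/-! ### Spaces of alternating forms of rank at most two. -/

section RankTwo

variable {k L : Type*} [Field k] [LieRing L] [LieAlgebra k L]

lemma mem_sup_span {A : Submodule k L} {u v : L} :
    v ∈ A ⊔ k ∙ u ↔ ∃ a ∈ A, ∃ c : k, a + c • u = v := by
  simp [Submodule.mem_sup, Submodule.mem_span_singleton]

/-- A subspace on which the bracket vanishes. -/
def IsCommutative (A : Submodule k L) : Prop := ∀ x ∈ A, ∀ y ∈ A, ⁅x, y⁆ = 0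

lemma IsCommutative.sup_span {A : Submodule k L} (hA : IsCommutative A) {u : L}
    (hu : ∀ x ∈ A, ⁅x, u⁆ = 0) : IsCommutative (A ⊔ k ∙ u) := by
  intro x hx y hy
  obtain ⟨a, ha, s, rfl⟩ := mem_sup_span.mp hx
  obtain ⟨b, hb, t, rfl⟩ := mem_sup_span.mp hy
  have h1 : ⁅u, b⁆ = 0 := by rw [← lie_skew, hu b hb, neg_zero]
  simp [hA a ha b hb, hu a ha, h1]

/-- The Pfaffian of the alternating form of `ξ` on four vectors. -/
def pfaffian (ξ : Dual k L) (x y z w : L) : k :=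
  ξ ⁅x, y⁆ * ξ ⁅z, w⁆ - ξ ⁅x, z⁆ * ξ ⁅y, w⁆ + ξ ⁅x, w⁆ * ξ ⁅y, z⁆

variable [FiniteDimensional k L]

lemma add_finrank_stabilizer_le_of_pfaffian {ξ : Dual k L} {H : Submodule k L}
    (hH : stabilizer ξ ≤ H) {x y z w : L} (hx : x ∈ H) (hy : y ∈ H) (hz : z ∈ H) (hw : w ∈ H)
    (h : pfaffian ξ x y z w ≠ 0) : 4 + finrank k (stabilizer ξ) ≤ finrank k H := by
  refine add_finrank_stabilizer_le_of_gram ξ H hH ![x, y, z, w] ?_ ?_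
  · intro i
    fin_cases i <;> assumption
  · have : (Matrix.of fun i j => ξ ⁅![x, y, z, w] i, ![x, y, z, w] j⁆).det =
        pfaffian ξ x y z w ^ 2 := by
      rw [pfaffian]
      simp [Matrix.det_succ_row_zero, Fin.sum_univ_succ, Fin.succAbove]
      rw [dual_lie_skew ξ y x, dual_lie_skew ξ z x, dual_lie_skew ξ w x, dual_lie_skew ξ z y,
        dual_lie_skew ξ w y, dual_lie_skew ξ w z]
      ring
    rw [this]
    exact pow_ne_zero 2 h

/-- A space of alternating forms of rank at most two, in Lie algebra terms. -/
theorem commutative_or_central_of_pfaffian (V : Submodule k L)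
    (hV : ∀ ξ : Dual k L, ∀ x ∈ V, ∀ y ∈ V, ∀ z ∈ V, ∀ w ∈ V, pfaffian ξ x y z w = 0) :
    (∃ A ≤ V, IsCommutative A ∧ finrank k V ≤ finrank k A + 1) ∨
      ∃ Z ≤ V, (∀ z ∈ Z, ∀ v ∈ V, ⁅z, v⁆ = 0) ∧ finrank k V = finrank k Z + 3 := by
  by_cases hab : IsCommutative V
  · exact Or.inl ⟨V, le_rfl, hab, by omega⟩
  unfold IsCommutative at hab
  push Not at hab
  obtain ⟨x, hx, y, hy, hxy⟩ := hab
  obtain ⟨ξ, hξ⟩ : ∃ ξ : Dual k L, ξ ⁅x, y⁆ ≠ 0 := by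
    by_contra! h
    exact hxy ((forall_dual_apply_eq_zero_iff k _).mp h)
  let N : Submodule k L := V ⊓ LinearMap.ker (kirillovForm ξ x) ⊓ LinearMap.ker (kirillovForm ξ y)
  have hN : ∀ v, v ∈ N ↔ v ∈ V ∧ ξ ⁅x, v⁆ = 0 ∧ ξ ⁅y, v⁆ = 0 := by
    intro v
    simp [N, and_assoc]
  have hyx : ξ ⁅y, x⁆ = -ξ ⁅x, y⁆ := dual_lie_skew ξ y x
  have hNV : N ≤ V := inf_le_left.trans inf_le_left
  have hxN : x ∉ N := fun h => hξ (by simpa [hyx] using ((hN x).mp h).2.2)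
  have hyN : y ∉ N ⊔ k ∙ x := by
    intro h
    obtain ⟨n, hn, c, hc⟩ := mem_sup_span.mp h
    apply hξ
    rw [← hc]
    simp [((hN n).mp hn).2.1]
  have hVN : V = N ⊔ k ∙ x ⊔ k ∙ y := by
    apply le_antisymm
    · intro v hv
      refine mem_sup_span.mpr
        ⟨v - (ξ ⁅x, v⁆ / ξ ⁅x, y⁆) • y, mem_sup_span.mpr
          ⟨v - (ξ ⁅x, v⁆ / ξ ⁅x, y⁆) • y + (ξ ⁅y, v⁆ / ξ ⁅x, y⁆) • x, (hN _).mpr ⟨?_, ?_, ?_⟩,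
            - (ξ ⁅y, v⁆ / ξ ⁅x, y⁆), by module⟩, ξ ⁅x, v⁆ / ξ ⁅x, y⁆, by module⟩
      · exact V.add_mem (V.sub_mem hv (V.smul_mem _ hy)) (V.smul_mem _ hx)
      · simp [hξ]
      · simp [hyx, hξ]
    · refine sup_le (sup_le hNV ?_) ?_ <;> simpa
  have hfin : finrank k V = finrank k N + 2 := by
    rw [hVN, Submodule.finrank_sup_span_singleton hyN, Submodule.finrank_sup_span_singleton hxN]
  have hpf : ∀ η : Dual k L, ∀ z ∈ N, ∀ w ∈ N, pfaffian η x y z w = 0 :=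
    fun η z hz w hw => hV η x hx y hy z (hNV hz) w (hNV hw)
  -- Polarization: ξ[x,·] and ξ[y,·] vanish on N, so the Pfaffians of ξ + η and of η differ only by
  -- ξ[x,y] η[z,w].
  have hNab : IsCommutative N := by
    intro z hz w hw
    refine (forall_dual_apply_eq_zero_iff k _).mp fun η => ?_
    obtain ⟨-, hz1, hz2⟩ := (hN z).mp hz
    obtain ⟨-, hw1, hw2⟩ := (hN w).mp hw
    have h1 := hpf ξ z hz w hw
    have h2 := hpf η z hz w hw
    have h3 := hpf (ξ + η) z hz w hw
    simp only [pfaffian, LinearMap.add_apply, hz1, hz2, hw1, hw2] at h1 h2 h3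
    have h4 : ξ ⁅z, w⁆ = 0 := by simpa [hξ] using h1
    rw [h4] at h3
    have h5 : ξ ⁅x, y⁆ * η ⁅z, w⁆ = 0 := by linear_combination h3 - h2
    exact (mul_eq_zero.mp h5).resolve_left hξ
  let R : L → Dual k L →ₗ[k] Dual k N := fun u =>
    (LinearMap.lcomp k k ((LieAlgebra.ad k L u : L →ₗ[k] L) ∘ₗ N.subtype))
  have hR : ∀ u η (n : N), R u η n = η ⁅u, (n : L)⁆ := fun u η n => rfl
  -- With N commutative, the vanishing Pfaffian says that η[x,·] and η[y,·] are parallel on N for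
  -- each η. Dependence then gives a combination of x, y that commutes with N; a common line kp
  -- gives Z = ker p.
  have hloc : ∀ η z w, R x η z * R y η w = R x η w * R y η z := by
    intro η z w
    have h2 := hpf η z z.2 w w.2
    rw [pfaffian, hNab z z.2 w w.2, map_zero] at h2
    simp only [hR]
    linear_combination -h2
  rcases locally_dependent hloc with ⟨a, b, hne, h0⟩ | ⟨p, hp, hpar⟩
  · left
    have hcomm : ∀ n ∈ N, ⁅n, a • x + b • y⁆ = 0 := by
      intro n hn
      rw [← lie_skew, neg_eq_zero]
      refine (forall_dual_apply_eq_zero_iff k _).mp fun η => ?_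
      have := LinearMap.congr_fun (LinearMap.congr_fun h0 η) ⟨n, hn⟩
      simpa [hR] using this
    have hu : a • x + b • y ∉ N := by
      intro h
      obtain ⟨-, h1, h2⟩ := (hN _).mp h
      simp [hξ] at h1
      simp [hyx, hξ] at h2
      exact hne ⟨h2, h1⟩
    refine ⟨N ⊔ k ∙ (a • x + b • y), sup_le hNV ?_, hNab.sup_span hcomm, ?_⟩
    · rw [Submodule.span_singleton_le_iff_mem]
      exact V.add_mem (V.smul_mem _ hx) (V.smul_mem _ hy)
    · rw [Submodule.finrank_sup_span_singleton hu]
      omega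
  · right
    refine ⟨(LinearMap.ker p).map N.subtype, ?_, ?_, ?_⟩
    · exact (Submodule.map_subtype_le _ _).trans hNV
    · rintro z hz v hv
      obtain ⟨n, hn, rfl⟩ := Submodule.mem_map.mp hz
      have hpn : p n = 0 := hn
      have hxn : ⁅x, (n : L)⁆ = 0 := by
        refine (forall_dual_apply_eq_zero_iff k _).mp fun η => ?_
        obtain ⟨c, hc⟩ := (hpar η).1
        rw [← hR, hc, LinearMap.smul_apply, hpn, smul_zero]
      have hyn : ⁅y, (n : L)⁆ = 0 := by
        refine (forall_dual_apply_eq_zero_iff k _).mp fun η => ?_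
        obtain ⟨c, hc⟩ := (hpar η).2
        rw [← hR, hc, LinearMap.smul_apply, hpn, smul_zero]
      rw [hVN] at hv
      obtain ⟨v1, hv1, c, rfl⟩ := mem_sup_span.mp hv
      obtain ⟨v2, hv2, d, rfl⟩ := mem_sup_span.mp hv1
      rw [← lie_skew]
      simp [hxn, hyn, hNab v2 hv2 n n.2]
    · rw [Submodule.finrank_map_subtype_eq, hfin]
      have := Module.Dual.finrank_ker_add_one_of_ne_zero hp
      omega

end RankTwo

/-! ### The exceptional case: a common radical of codimension three. -/

section ThreeDimensionalQuotient

variable {k L : Type*} [Field k] [LieRing L] [LieAlgebra k L]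

/-- Linear independence of three vectors modulo a subspace. -/
def IndepMod (Z : Submodule k L) (x y z : L) : Prop :=
  ∀ a b c : k, a • x + b • y + c • z ∈ Z → a = 0 ∧ b = 0 ∧ c = 0

lemma IndepMod.rotate {Z : Submodule k L} {x y z : L} (h : IndepMod Z x y z) :
    IndepMod Z y z x := by
  intro a b c habc
  obtain ⟨h1, h2, h3⟩ := h c a b (by
    convert habc using 1
    module)
  exact ⟨h2, h3, h1⟩

lemma indepMod_of_notMem {Z : Submodule k L} {x y z : L} (hz : z ∉ Z) (hy : y ∉ Z ⊔ k ∙ z)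
    (hx : x ∉ Z ⊔ k ∙ z ⊔ k ∙ y) : IndepMod Z x y z := by
  intro a b c h
  have ha : a = 0 := by
    by_contra ha
    refine hx (mem_sup_span.mpr ⟨a⁻¹ • (a • x + b • y + c • z) - (a⁻¹ * c) • z,
      mem_sup_span.mpr ⟨_, Z.smul_mem a⁻¹ h, -(a⁻¹ * c), by module⟩, -(a⁻¹ * b), ?_⟩)
    have : a⁻¹ • a • x = x := by rw [smul_smul, inv_mul_cancel₀ ha, one_smul]
    linear_combination (norm := module) this
  subst ha
  have hb : b = 0 := by
    by_contra hb
    refine hy (mem_sup_span.mpr ⟨_, Z.smul_mem b⁻¹ h, -(b⁻¹ * c), ?_⟩)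
    have : b⁻¹ • b • y = y := by rw [smul_smul, inv_mul_cancel₀ hb, one_smul]
    linear_combination (norm := module) this
  subst hb
  refine ⟨rfl, rfl, ?_⟩
  by_contra hc
  have : c⁻¹ • c • z = z := by rw [smul_smul, inv_mul_cancel₀ hc, one_smul]
  apply hz
  rw [← this]
  exact Z.smul_mem _ (by simpa using h)

lemma IndepMod.notMem {Z : Submodule k L} {x y z : L} (h : IndepMod Z x y z) :
    z ∉ Z ∧ y ∉ Z ⊔ k ∙ z ∧ x ∉ Z ⊔ k ∙ z ⊔ k ∙ y := by
  refine ⟨fun hz => ?_, fun hy => ?_, fun hx => ?_⟩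
  · have := (h 0 0 1 (by simpa using hz)).2.2
    exact one_ne_zero this
  · obtain ⟨a, ha, c, hc⟩ := mem_sup_span.mp hy
    refine one_ne_zero (h 0 1 (-c) ?_).2.1
    convert ha using 1
    rw [← hc]
    module
  · obtain ⟨a, ha, c, hc⟩ := mem_sup_span.mp hx
    obtain ⟨b, hb, d, hd⟩ := mem_sup_span.mp ha
    refine one_ne_zero (h 1 (-c) (-d) ?_).1
    convert hb using 1
    rw [← hc, ← hd]
    module

/-- A subspace `V` with a subspace `Z` of codimension three that commutes with `V`, such that
no hyperplane of `V` is commutative. -/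
structure IsFreeMod (Z V : Submodule k L) : Prop where
  le : Z ≤ V
  lie_eq_zero : ∀ z ∈ Z, ∀ v ∈ V, ⁅z, v⁆ = 0
  finrank_eq : finrank k V = finrank k Z + 3
  finrank_lt : ∀ A ≤ V, IsCommutative A → finrank k A + 1 < finrank k V

lemma IsFreeMod.lie_eq_zero' {Z V : Submodule k L} (h : IsFreeMod Z V) {v : L} (hv : v ∈ V) {z : L} (hz : z ∈ Z) : ⁅v, z⁆ = 0 := by
  rw [← lie_skew, h.lie_eq_zero z hz v hv, neg_zero]

variable [FiniteDimensional k L]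

lemma IndepMod.exists_coeff {Z V : Submodule k L} (hZV : Z ≤ V)
    (hfin : finrank k V = finrank k Z + 3) {x y z : L} (h : IndepMod Z x y z)
    (hx : x ∈ V) (hy : y ∈ V) (hz : z ∈ V) {v : L} (hv : v ∈ V) :
    ∃ ζ ∈ Z, ∃ a b c : k, v = ζ + a • x + b • y + c • z := by
  obtain ⟨h1, h2, h3⟩ := h.notMem
  have hV : Z ⊔ k ∙ z ⊔ k ∙ y ⊔ k ∙ x = V := by
    refine Submodule.eq_of_le_of_finrank_le
      (sup_le (sup_le (sup_le hZV ?_) ?_) ?_) ?_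
    · simpa
    · simpa
    · simpa
    · rw [Submodule.finrank_sup_span_singleton h3, Submodule.finrank_sup_span_singleton h2,
        Submodule.finrank_sup_span_singleton h1, hfin]
  rw [← hV] at hv
  obtain ⟨v1, hv1, a, rfl⟩ := mem_sup_span.mp hv
  obtain ⟨v2, hv2, b, rfl⟩ := mem_sup_span.mp hv1
  obtain ⟨v3, hv3, c, rfl⟩ := mem_sup_span.mp hv2
  exact ⟨v3, hv3, a, b, c, by module⟩

lemma exists_indepMod {Z V : Submodule k L} (hZV : Z ≤ V)
    (hfin : finrank k V = finrank k Z + 3) {z : L} (hz : z ∈ V) (hzZ : z ∉ Z) :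
    ∃ x ∈ V, ∃ y ∈ V, IndepMod Z x y z := by
  have hle1 : Z ⊔ k ∙ z ≤ V := sup_le hZV (by simpa)
  have h1 := Submodule.finrank_sup_span_singleton hzZ
  obtain ⟨y, hy, hyn⟩ := SetLike.exists_of_lt (lt_of_le_of_ne hle1 (by
    intro h
    rw [h] at h1
    omega))
  have h2 := Submodule.finrank_sup_span_singleton hyn
  have hle2 : Z ⊔ k ∙ z ⊔ k ∙ y ≤ V := sup_le hle1 (by simpa)
  obtain ⟨x, hx, hxn⟩ := SetLike.exists_of_lt (lt_of_le_of_ne hle2 (by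
    intro h
    rw [h] at h2
    omega))
  exact ⟨x, hx, y, hy, indepMod_of_notMem hzZ hyn hxn⟩

namespace IsFreeMod

variable {Z V : Submodule k L} (h : IsFreeMod Z V)
include h

lemma exists_basis : ∃ x ∈ V, ∃ y ∈ V, ∃ z ∈ V, IndepMod Z x y z := by
  obtain ⟨z, hz, hzn⟩ := SetLike.exists_of_lt (lt_of_le_of_ne h.le (by
    intro he
    have := h.finrank_eq
    rw [he] at this
    omega))
  obtain ⟨x, hx, y, hy, hi⟩ := exists_indepMod h.le h.finrank_eq hz hzn
  exact ⟨x, hx, y, hy, z, hz, hi⟩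

lemma lie_ne_zero {u v : L} (hu : u ∈ V) (hv : v ∈ V) (huZ : u ∉ Z) (hvZ : v ∉ Z ⊔ k ∙ u) :
    ⁅u, v⁆ ≠ 0 := by
  intro h0
  have hZ : IsCommutative Z := fun x hx y hy => h.lie_eq_zero x hx y (h.le hy)
  have h1 : IsCommutative (Z ⊔ k ∙ u) := hZ.sup_span fun x hx => h.lie_eq_zero x hx u hu
  have h2 : IsCommutative (Z ⊔ k ∙ u ⊔ k ∙ v) := h1.sup_span fun x hx => by
    obtain ⟨a, ha, c, rfl⟩ := mem_sup_span.mp hx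
    simp [h.lie_eq_zero a ha v hv, h0]
  have h3 := h.finrank_lt _ (sup_le (sup_le h.le (by simpa)) (by simpa)) h2
  rw [Submodule.finrank_sup_span_singleton hvZ, Submodule.finrank_sup_span_singleton huZ,
    h.finrank_eq] at h3
  omega

/-- Every bivector in three dimensions is decomposable: for c ≠ 0 the relation, times c, is the
bracket of cx - az and cy - bz. If that bracket vanished, Z and these two vectors would span a
commutative hyperplane of V. -/
lemma lie_coeff_eq_zero {x y z : L} (hi : IndepMod Z x y z) (hx : x ∈ V) (hy : y ∈ V)
    (hz : z ∈ V) {a b c : k} (h0 : a • ⁅y, z⁆ + b • ⁅z, x⁆ + c • ⁅x, y⁆ = 0) : c = 0 := by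
  by_contra hc
  have key : ∀ s t : k, s • (c • x - a • z) + t • (c • y - b • z) ∈ Z → s = 0 ∧ t = 0 := by
    intro s t hst
    obtain ⟨h1, h2, -⟩ := hi (s * c) (t * c) (-(s * a) - t * b) (by
      convert hst using 1
      module)
    exact ⟨(mul_eq_zero.mp h1).resolve_right hc, (mul_eq_zero.mp h2).resolve_right hc⟩
  refine h.lie_ne_zero (u := c • x - a • z) (v := c • y - b • z)
    (V.sub_mem (V.smul_mem _ hx) (V.smul_mem _ hz))
    (V.sub_mem (V.smul_mem _ hy) (V.smul_mem _ hz)) (fun hu => ?_) (fun hv => ?_) ?_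
  · exact one_ne_zero (key 1 0 (by simpa using hu)).1
  · obtain ⟨w, hw, s, hs⟩ := mem_sup_span.mp hv
    refine one_ne_zero (key (-s) 1 ?_).2
    convert hw using 1
    linear_combination (norm := module) -hs
  · have h1 : ⁅x, z⁆ = -⁅z, x⁆ := (lie_skew x z).symm
    have h2 : ⁅z, y⁆ = -⁅y, z⁆ := (lie_skew z y).symm
    simp only [lie_sub, sub_lie, lie_smul, smul_lie, lie_self, h1, h2]
    linear_combination (norm := module) c • h0

lemma lie_indep {x y z : L} (hi : IndepMod Z x y z) (hx : x ∈ V) (hy : y ∈ V)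
    (hz : z ∈ V) {a b c : k} (h0 : a • ⁅y, z⁆ + b • ⁅z, x⁆ + c • ⁅x, y⁆ = 0) :
    a = 0 ∧ b = 0 ∧ c = 0 :=
  ⟨h.lie_coeff_eq_zero (a := b) (b := c) hi.rotate hy hz hx (by rw [← h0]; module),
    h.lie_coeff_eq_zero (a := c) (b := a) hi.rotate.rotate hz hx hy (by rw [← h0]; module),
    h.lie_coeff_eq_zero hi hx hy hz h0⟩

/-- If the kernels of the forms on `V` can be corrected by `Z` to lie in the stabilizers, the
semiradical is not commutative. -/
lemma semiradical_not_commutative [Infinite k] (hF : frobeniusSemiradical k L ≤ V) {v₀ : L}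
    (hv₀ : v₀ ≠ 0)
    (hst : ∀ ξ ∈ regularSet k L, ξ v₀ ≠ 0 → ∀ v ∈ V, (∀ y ∈ V, ξ ⁅v, y⁆ = 0) →
      ∃ z ∈ Z, v + z ∈ stabilizer ξ) :
    ¬ IsCommutative (frobeniusSemiradical k L) := by
  intro hcomm
  have hne : ¬ V ≤ frobeniusSemiradical k L ⊔ Z := by
    intro hle
    have hV : IsCommutative V := by
      intro x hx y hy
      obtain ⟨f, hf, z, hz, rfl⟩ := Submodule.mem_sup.mp (hle hx)
      obtain ⟨g, hg, w, hw, rfl⟩ := Submodule.mem_sup.mp (hle hy)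
      simp only [lie_add, add_lie]
      rw [hcomm f hf g hg, h.lie_eq_zero z hz g (hF hg), h.lie_eq_zero z hz w (h.le hw),
        h.lie_eq_zero' (hF hf) hw]
      simp
    have := h.finrank_lt V le_rfl hV
    omega
  obtain ⟨u, hu, hun⟩ := SetLike.not_le_iff_exists.mp hne
  obtain ⟨μ, hμu, hμ⟩ := Submodule.exists_le_ker_of_notMem hun
  have hμF : ∀ f ∈ frobeniusSemiradical k L, μ f = 0 := fun f hf =>
    hμ (Submodule.mem_sup_left hf)
  have hμZ : ∀ f ∈ Z, μ f = 0 := fun f hf => hμ (Submodule.mem_sup_right hf)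
  obtain ⟨x, hx, y, hy, z, hz, hi⟩ := h.exists_basis
  -- The vector ξ[y,z]x + ξ[z,x]y + ξ[x,y]z lies in the kernel of B_ξ on V, and μ takes the value
  -- ξ(w) on it, with w the vector here. A regular ξ with ξ(w) ≠ 0 then contradicts that μ kills
  -- F(L) and Z.
  have hw : μ x • ⁅y, z⁆ + μ y • ⁅z, x⁆ + μ z • ⁅x, y⁆ ≠ 0 := by
    intro h0
    obtain ⟨h1, h2, h3⟩ := h.lie_indep hi hx hy hz h0
    obtain ⟨ζ, hζ, a, b, c, rfl⟩ := hi.exists_coeff h.le h.finrank_eq hx hy hz hu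
    apply hμu
    simp [hμZ ζ hζ, h1, h2, h3]
  obtain ⟨ξ, hξ, hξv, hξw⟩ := exists_regular_ne_zero (k := k) hv₀ hw
  have hvV : ξ ⁅y, z⁆ • x + ξ ⁅z, x⁆ • y + ξ ⁅x, y⁆ • z ∈ V :=
    V.add_mem (V.add_mem (V.smul_mem _ hx) (V.smul_mem _ hy)) (V.smul_mem _ hz)
  obtain ⟨ζ, hζ, hmem⟩ := hst ξ hξ hξv _ hvV (by
    intro w hw
    obtain ⟨ζ, hζ, a, b, c, rfl⟩ := hi.exists_coeff h.le h.finrank_eq hx hy hz hw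
    have h1 := h.lie_eq_zero' hx hζ
    have h2 := h.lie_eq_zero' hy hζ
    have h3 := h.lie_eq_zero' hz hζ
    simp only [lie_add, add_lie, lie_smul, smul_lie, lie_self, map_add, map_smul, smul_eq_mul, h1,
      h2, h3, map_zero, dual_lie_skew ξ x z, dual_lie_skew ξ z y, dual_lie_skew ξ y x]
    ring)
  have := hμF _ (stabilizer_le_semiradical hξ hmem)
  rw [map_add, hμZ ζ hζ, add_zero] at this
  apply hξw
  simp only [map_add, map_smul, smul_eq_mul] at this ⊢
  linear_combination this

end IsFreeMod

lemma exists_commutative_or_isFreeMod (V : Submodule k L)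
    (hV : ∀ ξ : Dual k L, ∀ x ∈ V, ∀ y ∈ V, ∀ z ∈ V, ∀ w ∈ V, pfaffian ξ x y z w = 0) :
    (∃ A ≤ V, IsCommutative A ∧ finrank k V ≤ finrank k A + 1) ∨ ∃ Z, IsFreeMod Z V := by
  by_cases h1 : ∃ A ≤ V, IsCommutative A ∧ finrank k V ≤ finrank k A + 1
  · exact Or.inl h1
  rcases commutative_or_central_of_pfaffian V hV with h2 | ⟨Z, hZV, hZ, hfin⟩
  · exact Or.inl h2
  · push Not at h1
    exact Or.inr ⟨Z, hZV, hZ, hfin, h1⟩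

lemma exists_commutative_codim_two (V : Submodule k L)
    (hV : ∀ ξ : Dual k L, ∀ x ∈ V, ∀ y ∈ V, ∀ z ∈ V, ∀ w ∈ V, pfaffian ξ x y z w = 0) :
    ∃ A ≤ V, IsCommutative A ∧ finrank k V ≤ finrank k A + 2 := by
  rcases exists_commutative_or_isFreeMod V hV with ⟨A, hA, hc, hf⟩ | ⟨Z, h⟩
  · exact ⟨A, hA, hc, by omega⟩
  · obtain ⟨x, hx, y, hy, z, hz, hi⟩ := h.exists_basis
    refine ⟨Z ⊔ k ∙ z, sup_le h.le (by simpa), ?_, ?_⟩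
    · exact IsCommutative.sup_span (fun a ha b hb => h.lie_eq_zero a ha b (h.le hb))
        fun a ha => h.lie_eq_zero a ha z hz
    · rw [Submodule.finrank_sup_span_singleton hi.notMem.1, h.finrank_eq]

end ThreeDimensionalQuotient

/-! ### Two consequences of nilpotency. -/

section Nilpotent

variable {k L : Type*} [Field k] [LieRing L] [LieAlgebra k L]

/-- Otherwise brackets could be repeated without ever entering Z, while descending the lower central
series to zero. -/
lemma exists_notMem_lie_mem [LieRing.IsNilpotent L] (I Z : Submodule k L)
    (hI : ∀ l : L, ∀ z ∈ I, ⁅l, z⁆ ∈ I) (hIZ : ¬ I ≤ Z) :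
    ∃ z ∈ I, z ∉ Z ∧ ∀ l : L, ⁅l, z⁆ ∈ Z := by
  by_contra! hcon
  obtain ⟨m, hm⟩ := LieModule.IsNilpotent.nilpotent k L L
  have key : ∀ m, ∃ z ∈ I, z ∉ Z ∧ z ∈ LieModule.lowerCentralSeries k L L m := by
    intro m
    induction m with
    | zero =>
      obtain ⟨z, hz, hzn⟩ := SetLike.not_le_iff_exists.mp hIZ
      exact ⟨z, hz, hzn, by simp⟩
    | succ m ih =>
      obtain ⟨z, hz, hzn, hzm⟩ := ih
      obtain ⟨l, hl⟩ := hcon z hz hzn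
      refine ⟨⁅l, z⁆, hI l z hz, hl, ?_⟩
      rw [LieModule.lowerCentralSeries_succ]
      exact LieSubmodule.lie_mem_lie (LieSubmodule.mem_top l) hzm
  obtain ⟨z, -, hzn, hz⟩ := key m
  rw [hm] at hz
  exact hzn (by rw [(LieSubmodule.mem_bot z).mp hz]; exact Z.zero_mem)

variable [FiniteDimensional k L]

/-- In a nilpotent Lie algebra, a proper subalgebra lies in a hyperplane that contains the derived
algebra. -/
lemma exists_hyperplane [LieRing.IsNilpotent L] (F : Submodule k L) (hF : F ≠ ⊤)
    (hFI : ∀ x ∈ F, ∀ y ∈ F, ⁅x, y⁆ ∈ F) :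
    ∃ H : Submodule k L, F ≤ H ∧ finrank k H + 1 = finrank k L ∧ ∀ x y : L, ⁅x, y⁆ ∈ H := by
  let D : Submodule k L := Submodule.span k {z | ∃ x y : L, ⁅x, y⁆ = z}
  have hne : F ⊔ D < ⊤ := by
    refine lt_top_iff_ne_top.mpr fun htop => ?_
    obtain ⟨m, hm⟩ := LieModule.IsNilpotent.nilpotent k L L
    -- A subalgebra that generates L modulo the derived algebra is all of L: expanding [f+c, g+d]
    -- moves the error one step down the series.
    have key : ∀ m, ∀ z : L, z ∈ F ⊔ (LieModule.lowerCentralSeries k L L m : Submodule k L) := by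
      intro m
      induction m with
      | zero => intro z; simp
      | succ m ih =>
        intro z
        have hz : z ∈ F ⊔ D := htop ▸ Submodule.mem_top
        refine (sup_le le_sup_left (Submodule.span_le.mpr ?_) : F ⊔ D ≤ _) hz
        rintro _ ⟨x, y, rfl⟩
        obtain ⟨f, hf, c, hc, rfl⟩ := Submodule.mem_sup.mp (ih x)
        obtain ⟨g, hg, d, hd, rfl⟩ := Submodule.mem_sup.mp (ih y)
        rw [lie_add, add_lie f c g, add_assoc]
        refine add_mem (Submodule.mem_sup_left (hFI f hf g hg)) (Submodule.mem_sup_right ?_)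
        rw [LieModule.lowerCentralSeries_succ]
        refine add_mem ?_ (LieSubmodule.lie_mem_lie (LieSubmodule.mem_top _) hd)
        rw [← lie_skew]
        exact neg_mem (LieSubmodule.lie_mem_lie (LieSubmodule.mem_top g) hc)
    apply hF
    rw [eq_top_iff]
    intro z _
    obtain ⟨f, hf, c, hc, rfl⟩ := Submodule.mem_sup.mp (key m z)
    rw [hm] at hc
    rw [(LieSubmodule.mem_bot (R := k) (L := L) c).mp hc, add_zero]
    exact hf
  obtain ⟨f, hf, hle⟩ := Submodule.exists_le_ker_of_lt_top _ hne
  refine ⟨LinearMap.ker f, le_sup_left.trans hle, Module.Dual.finrank_ker_add_one_of_ne_zero hf,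
    fun x y => hle (Submodule.mem_sup_right (Submodule.subset_span ⟨x, y, rfl⟩))⟩

end Nilpotent

/-! ### Commutative subspaces of codimension two when Z is central. -/

section CodimensionTwo

variable {k L : Type*} [Field k] [LieRing L] [LieAlgebra k L] [FiniteDimensional k L]

lemma exists_isotropic_pair [IsAlgClosed k] [CharZero k] (a b c : k) :
    ∃ α β : k, ¬ (α = 0 ∧ β = 0) ∧ a * α ^ 2 + b * α * β + c * β ^ 2 = 0 := by
  by_cases ha : a = 0
  · exact ⟨1, 0, by simp, by simp [ha]⟩
  · obtain ⟨s, hs⟩ := IsAlgClosed.exists_eq_mul_self (b ^ 2 - 4 * a * c)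
    refine ⟨(-b + s) / (2 * a), 1, by simp, ?_⟩
    field_simp
    linear_combination -hs

lemma exists_perp_coeff {α β C₁ C₂ : k} (hne : ¬ (α = 0 ∧ β = 0)) (h : α * C₁ + β * C₂ = 0) :
    ∃ p : k, C₁ = p * β ∧ C₂ = -(p * α) := by
  by_cases hα : α = 0
  · have hβ : β ≠ 0 := fun hβ => hne ⟨hα, hβ⟩
    refine ⟨C₁ / β, by field_simp, ?_⟩
    rw [hα] at h ⊢
    simpa [hβ] using h
  · refine ⟨-(C₂ / α), ?_, by field_simp⟩
    field_simp
    linear_combination h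

lemma exists_det_coeff {α β : k} (C : k) (hne : ¬ (α = 0 ∧ β = 0)) :
    ∃ δ ε : k, C = ε * α - δ * β := by
  by_cases hα : α = 0
  · have hβ : β ≠ 0 := fun hβ => hne ⟨hα, hβ⟩
    exact ⟨-(C / β), 0, by field_simp; ring⟩
  · exact ⟨0, C / α, by field_simp; ring⟩

namespace IsFreeMod

variable {Z H : Submodule k L}

/-- The three brackets form a basis of Z, so Z ≅ Λ²(H/Z). A vector u of H commutes with some t + v,
v ∈ H, as soon as [t,u] ∈ [u,H]. This is one quadratic equation in u, solvable on the plane of x, y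
since k is algebraically closed. -/
lemma exists_commutative_of_lie_mem [IsAlgClosed k] [CharZero k] (h : IsFreeMod Z H)
    (hZ : ∀ z ∈ Z, ∀ l : L, ⁅z, l⁆ = 0) (hlie : ∀ x y : L, ⁅x, y⁆ ∈ H) {t : L} (ht : t ∉ H)
    (hH : ∀ x ∈ H, ∀ y ∈ H, ⁅x, y⁆ ∈ Z) (hfin : finrank k Z ≤ 3) :
    ∃ A : Submodule k L, IsCommutative A ∧ finrank k A = finrank k Z + 2 := by
  have hZ' : ∀ z ∈ Z, ∀ l : L, ⁅l, z⁆ = 0 := fun z hz l => by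
    rw [← lie_skew, hZ z hz, neg_zero]
  obtain ⟨x, hx, y, hy, z, hz, hi⟩ := h.exists_basis
  have hcoef : ∀ v : L, ∃ ζ ∈ Z, ∃ a b c : k, ⁅t, v⁆ = ζ + a • x + b • y + c • z := fun v =>
    hi.exists_coeff h.le h.finrank_eq hx hy hz (hlie t v)
  have hzx : ⁅x, z⁆ = -⁅z, x⁆ := (lie_skew x z).symm
  have hyz : ⁅z, y⁆ = -⁅y, z⁆ := (lie_skew z y).symm
  have hxy : ⁅y, x⁆ = -⁅x, y⁆ := (lie_skew y x).symm
  obtain ⟨ζ₁, hζ₁, a₁, a₂, a₃, ha⟩ := hcoef x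
  obtain ⟨ζ₂, hζ₂, b₁, b₂, b₃, hb⟩ := hcoef y
  obtain ⟨ζ₃, hζ₃, c₁, c₂, c₃, hc⟩ := hcoef z
  -- As Z is central, ad t kills [H,H], so the map it induces on H/Z acts by zero on Λ²(H/Z). In
  -- dimension three and characteristic not two that map is itself zero.
  have e₁ : ⁅⁅t, x⁆, y⁆ + ⁅x, ⁅t, y⁆⁆ = 0 := by
    rw [← leibniz_lie]; exact hZ' _ (hH x hx y hy) t
  have e₂ : ⁅⁅t, y⁆, z⁆ + ⁅y, ⁅t, z⁆⁆ = 0 := by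
    rw [← leibniz_lie]; exact hZ' _ (hH y hy z hz) t
  have e₃ : ⁅⁅t, z⁆, x⁆ + ⁅z, ⁅t, x⁆⁆ = 0 := by
    rw [← leibniz_lie]; exact hZ' _ (hH z hz x hx) t
  rw [ha, hb] at e₁
  rw [hb, hc] at e₂
  rw [hc, ha] at e₃
  simp only [lie_add, add_lie, lie_smul, smul_lie, lie_self, hZ _ hζ₁, hZ _ hζ₂, hZ _ hζ₃,
    hZ' _ hζ₁, hZ' _ hζ₂, hZ' _ hζ₃, hzx, hyz, hxy] at e₁ e₂ e₃
  obtain ⟨f₁, f₂, f₃⟩ := h.lie_indep (a := -a₃) (b := -b₃) (c := a₁ + b₂) hi hx hy hz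
    (by rw [← e₁]; module)
  obtain ⟨g₁, g₂, g₃⟩ := h.lie_indep (a := b₂ + c₃) (b := -b₁) (c := -c₁) hi hx hy hz
    (by rw [← e₂]; module)
  obtain ⟨h₁, h₂, h₃⟩ := h.lie_indep (a := -a₂) (b := c₃ + a₁) (c := -c₂) hi hx hy hz
    (by rw [← e₃]; module)
  have ha1 : a₁ = 0 := by linear_combination (f₃ - g₁ + h₂) / 2
  have hb2 : b₂ = 0 := by linear_combination f₃ - ha1
  have hax : ⁅t, x⁆ ∈ Z := by
    rw [ha, ha1, neg_eq_zero.mp h₁, neg_eq_zero.mp f₁]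
    simpa using hζ₁
  have hby : ⁅t, y⁆ ∈ Z := by
    rw [hb, neg_eq_zero.mp g₂, hb2, neg_eq_zero.mp f₂]
    simpa using hζ₂
  have hspan : ∀ v ∈ Z, ∃ a b c : k, v = a • ⁅y, z⁆ + b • ⁅z, x⁆ + c • ⁅x, y⁆ := by
    intro v hv
    have hi0 : IndepMod (⊥ : Submodule k L) ⁅y, z⁆ ⁅z, x⁆ ⁅x, y⁆ := fun a b c h0 =>
      h.lie_indep hi hx hy hz ((Submodule.mem_bot k).mp h0)
    obtain ⟨n1, n2, n3⟩ := hi0.notMem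
    have hd := Submodule.finrank_sup_span_singleton n3
    rw [Submodule.finrank_sup_span_singleton n2, Submodule.finrank_sup_span_singleton n1,
      finrank_bot] at hd
    have hle : ⊥ ⊔ k ∙ ⁅x, y⁆ ⊔ k ∙ ⁅z, x⁆ ⊔ k ∙ ⁅y, z⁆ ≤ Z :=
      sup_le (sup_le (sup_le bot_le (by simpa using hH x hx y hy)) (by simpa using hH z hz x hx))
        (by simpa using hH y hy z hz)
    have hd' := Submodule.finrank_mono hle
    obtain ⟨ζ, hζ, a, b, c, rfl⟩ := hi0.exists_coeff (V := Z) bot_le (by rw [finrank_bot]; omega)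
      (hH y hy z hz) (hH z hz x hx) (hH x hx y hy) hv
    rw [(Submodule.mem_bot k).mp hζ]
    exact ⟨a, b, c, by module⟩
  obtain ⟨A₁, A₂, A₃, hA⟩ := hspan _ hax
  obtain ⟨B₁, B₂, B₃, hB⟩ := hspan _ hby
  obtain ⟨α, β, hne, hq⟩ := exists_isotropic_pair A₁ (B₁ + A₂) B₂
  obtain ⟨p, hp₁, hp₂⟩ := exists_perp_coeff (C₁ := α * A₁ + β * B₁) (C₂ := α * A₂ + β * B₂) hne
    (by linear_combination hq)
  obtain ⟨δ, ε, hδ⟩ := exists_det_coeff (α * A₃ + β * B₃) hne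
  have hcomm : ⁅α • x + β • y, t + (δ • x + ε • y + p • z)⁆ = 0 := by
    have hxt : ⁅x, t⁆ = -⁅t, x⁆ := (lie_skew x t).symm
    have hyt : ⁅y, t⁆ = -⁅t, y⁆ := (lie_skew y t).symm
    simp only [lie_add, add_lie, lie_smul, smul_lie, lie_self, hzx, hxy, hxt, hyt, hA, hB]
    linear_combination (norm := module) (-hp₁) • ⁅y, z⁆ - hp₂ • ⁅z, x⁆ - hδ • ⁅x, y⁆
  have hu : α • x + β • y ∈ H := H.add_mem (H.smul_mem _ hx) (H.smul_mem _ hy)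
  have huZ : α • x + β • y ∉ Z := fun hmem => hne (by
    obtain ⟨q1, q2, -⟩ := hi α β 0 (by simpa using hmem)
    exact ⟨q1, q2⟩)
  have htn : t + (δ • x + ε • y + p • z) ∉ Z ⊔ k ∙ (α • x + β • y) := by
    intro hmem
    have h1 : t + (δ • x + ε • y + p • z) ∈ H := (sup_le h.le (by simpa using hu)) hmem
    exact ht ((H.add_mem_iff_left (H.add_mem (H.add_mem (H.smul_mem _ hx) (H.smul_mem _ hy))
      (H.smul_mem _ hz))).mp h1)
  refine ⟨Z ⊔ k ∙ (α • x + β • y) ⊔ k ∙ (t + (δ • x + ε • y + p • z)), ?_, ?_⟩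
  · refine IsCommutative.sup_span (IsCommutative.sup_span (fun a ha b _ => hZ a ha b)
      fun a ha => hZ a ha _) ?_
    intro v hv
    obtain ⟨a, ha, s, rfl⟩ := mem_sup_span.mp hv
    rw [add_lie, hZ a ha, smul_lie, hcomm, smul_zero, add_zero]
  · rw [Submodule.finrank_sup_span_singleton htn, Submodule.finrank_sup_span_singleton huZ]

/-- Nilpotency gives z in the span of [H,H], outside Z, with [L,z] ≤ Z. Modulo Z that span is then
the line of w = [x,y], so w can replace z, and t can be corrected by x and y to commute with w. -/
lemma exists_commutative_of_not_lie_mem [LieRing.IsNilpotent L] (h : IsFreeMod Z H)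
    (hZ : ∀ z ∈ Z, ∀ l : L, ⁅z, l⁆ = 0) (hlie : ∀ x y : L, ⁅x, y⁆ ∈ H) {t : L} (ht : t ∉ H)
    (hH : ¬ ∀ x ∈ H, ∀ y ∈ H, ⁅x, y⁆ ∈ Z) :
    ∃ A : Submodule k L, IsCommutative A ∧ finrank k A = finrank k Z + 2 := by
  have hZ' : ∀ z ∈ Z, ∀ l : L, ⁅l, z⁆ = 0 := fun z hz l => by
    rw [← lie_skew, hZ z hz, neg_zero]
  let I : Submodule k L := Submodule.span k {z | ∃ x ∈ H, ∃ y ∈ H, ⁅x, y⁆ = z}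
  have hII : ∀ l : L, ∀ z ∈ I, ⁅l, z⁆ ∈ I := by
    intro l z hz
    induction hz using Submodule.span_induction with
    | mem z hz =>
      obtain ⟨x, hx, y, hy, rfl⟩ := hz
      rw [leibniz_lie]
      exact I.add_mem (Submodule.subset_span ⟨_, hlie l x, y, hy, rfl⟩)
        (Submodule.subset_span ⟨x, hx, _, hlie l y, rfl⟩)
    | zero => simp
    | add a b _ _ ha hb => rw [lie_add]; exact I.add_mem ha hb
    | smul c a _ ha => rw [lie_smul]; exact I.smul_mem _ ha
  have hIZ : ¬ I ≤ Z := fun hle => hH fun x hx y hy =>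
    hle (Submodule.subset_span ⟨x, hx, y, hy, rfl⟩)
  have hIH : I ≤ H := Submodule.span_le.mpr (by
    rintro _ ⟨x, -, y, -, rfl⟩
    exact hlie x y)
  obtain ⟨z, hzI, hzZ, hzl⟩ := exists_notMem_lie_mem I Z hII hIZ
  obtain ⟨x, hx, y, hy, hi⟩ := exists_indepMod h.le h.finrank_eq (hIH hzI) hzZ
  have hz := hIH hzI
  have hzl' : ∀ l : L, ⁅z, l⁆ ∈ Z := fun l => by
    rw [← lie_skew]; exact Z.neg_mem (hzl l)
  have hIle : I ≤ Z ⊔ k ∙ ⁅x, y⁆ := by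
    refine Submodule.span_le.mpr ?_
    rintro _ ⟨u, hu, v, hv, rfl⟩
    obtain ⟨ζ, hζ, a, b, c, rfl⟩ := hi.exists_coeff h.le h.finrank_eq hx hy hz hu
    obtain ⟨ω, hω, a', b', c', rfl⟩ := hi.exists_coeff h.le h.finrank_eq hx hy hz hv
    have hxy : ⁅y, x⁆ = -⁅x, y⁆ := (lie_skew y x).symm
    refine mem_sup_span.mpr ⟨a • c' • ⁅x, z⁆ + b • c' • ⁅y, z⁆ + c • a' • ⁅z, x⁆ +
      c • b' • ⁅z, y⁆, ?_, a * b' - b * a', ?_⟩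
    · exact Z.add_mem (Z.add_mem (Z.add_mem (Z.smul_mem _ (Z.smul_mem _ (hzl x)))
        (Z.smul_mem _ (Z.smul_mem _ (hzl y)))) (Z.smul_mem _ (Z.smul_mem _ (hzl' x))))
        (Z.smul_mem _ (Z.smul_mem _ (hzl' y)))
    · simp only [lie_add, add_lie, lie_smul, smul_lie, lie_self, hZ _ hζ, hZ' _ hω, hxy]
      module
  obtain ⟨ζ, hζ, c, hc⟩ := mem_sup_span.mp (hIle hzI)
  have hc0 : c ≠ 0 := by
    rintro rfl
    exact hzZ (by rw [← hc]; simpa using hζ)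
  set w : L := ⁅x, y⁆ with hw
  have hwH : w ∈ H := hlie x y
  have hwl : ∀ l : L, ⁅l, w⁆ ∈ Z := fun l => by
    have h1 := hzl l
    rw [← hc, lie_add, hZ' ζ hζ, zero_add, lie_smul] at h1
    exact (Z.smul_mem_iff hc0).mp h1
  have hiw : IndepMod Z x y w := by
    intro a b d hmem
    obtain ⟨q1, q2, q3⟩ := hi (c * a) (c * b) d (by
      rw [← hc]
      have := Z.add_mem (Z.smul_mem c hmem) (Z.smul_mem d hζ)
      convert this using 1
      module)
    exact ⟨(mul_eq_zero.mp q1).resolve_left hc0, (mul_eq_zero.mp q2).resolve_left hc0, q3⟩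
  -- Bracketing [u,w] ∈ Z with t gives [[t,u],w] = 0, and freeness removes the x and y components of
  -- [t,u].
  have hkey : ∀ u ∈ H, ∃ ω ∈ Z, ∃ d : k, ⁅t, u⁆ = ω + d • w := by
    intro u hu
    obtain ⟨ω, hω, a, b, d, he⟩ :=
      hiw.exists_coeff h.le h.finrank_eq hx hy hwH (hlie t u)
    have h1 : ⁅t, ⁅u, w⁆⁆ = 0 := hZ' _ (hwl u) t
    have hwx : ⁅x, w⁆ = -⁅w, x⁆ := (lie_skew x w).symm
    rw [leibniz_lie, hZ' _ (hwl t), add_zero, he] at h1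
    simp only [add_lie, smul_lie, lie_self, hZ _ hω, hwx] at h1
    obtain ⟨ha, hb, -⟩ := h.lie_indep (a := b) (b := -a) (c := 0) hiw hx hy hwH
      (by rw [← h1]; module)
    exact ⟨ω, hω, d, by rw [he, ha, neg_eq_zero.mp hb]; module⟩
  obtain ⟨ω₁, hω₁, p, hp⟩ := hkey x hx
  obtain ⟨ω₂, hω₂, q, hq⟩ := hkey y hy
  have hxy : ⁅y, x⁆ = -w := (lie_skew y x).symm
  have hcomm : ⁅t + (p • y - q • x), w⁆ = 0 := by
    have h1 : ⁅t + (p • y - q • x), x⁆ = ω₁ := by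
      simp only [add_lie, sub_lie, smul_lie, lie_self, hxy, hp]
      module
    have h2 : ⁅t + (p • y - q • x), y⁆ = ω₂ := by
      simp only [add_lie, sub_lie, smul_lie, lie_self, ← hw, hq]
      module
    rw [hw, leibniz_lie, h1, h2, hZ _ hω₁, hZ' _ hω₂, add_zero]
  have htn : t + (p • y - q • x) ∉ Z ⊔ k ∙ w := by
    intro hmem
    have h1 : t + (p • y - q • x) ∈ H := (sup_le h.le (by simpa using hwH)) hmem
    exact ht ((H.add_mem_iff_left (H.sub_mem (H.smul_mem _ hy) (H.smul_mem _ hx))).mp h1)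
  refine ⟨Z ⊔ k ∙ w ⊔ k ∙ (t + (p • y - q • x)), ?_, ?_⟩
  · refine IsCommutative.sup_span (IsCommutative.sup_span (fun a ha b _ => hZ a ha b)
      fun a ha => hZ a ha _) ?_
    intro v hv
    obtain ⟨a, ha, s, rfl⟩ := mem_sup_span.mp hv
    rw [add_lie, hZ a ha, smul_lie, ← lie_skew w, hcomm, neg_zero, smul_zero, add_zero]
  · rw [Submodule.finrank_sup_span_singleton htn,
      Submodule.finrank_sup_span_singleton hiw.notMem.1]

end IsFreeMod

/-- A nilpotent Lie algebra of dimension at most seven with a hyperplane that contains the derived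
algebra and the commutative semiradical, and on which all forms have rank at most two, has a
commutative subspace of codimension two. -/
theorem exists_commutative_of_hyperplane [IsAlgClosed k] [CharZero k] [LieRing.IsNilpotent L]
    (hn : finrank k L ≤ 7) (H : Submodule k L) (hfin : finrank k H + 1 = finrank k L)
    (hlie : ∀ x y : L, ⁅x, y⁆ ∈ H) (hF : frobeniusSemiradical k L ≤ H)
    (hFc : IsCommutative (frobeniusSemiradical k L))
    (hH : ∀ ξ : Dual k L, ∀ x ∈ H, ∀ y ∈ H, ∀ z ∈ H, ∀ w ∈ H, pfaffian ξ x y z w = 0) :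
    ∃ A : Submodule k L, IsCommutative A ∧ finrank k L ≤ finrank k A + 2 := by
  rcases exists_commutative_or_isFreeMod H hH with ⟨A, -, hA, hAf⟩ | ⟨Z, h⟩
  · exact ⟨A, hA, by omega⟩
  have hdim := h.finrank_eq
  obtain ⟨t, -, ht⟩ := SetLike.exists_of_lt (lt_top_iff_ne_top.mpr (show H ≠ ⊤ by
    rintro rfl
    rw [finrank_top] at hfin
    omega))
  have htop : H ⊔ k ∙ t = ⊤ := by
    apply Submodule.eq_top_of_finrank_eq
    rw [Submodule.finrank_sup_span_singleton ht, hfin]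
  have hdecomp : ∀ l : L, ∃ v ∈ H, ∃ s : k, v + s • t = l := fun l =>
    mem_sup_span.mp (htop ▸ Submodule.mem_top)
  by_cases hZt : ∀ z ∈ Z, ⁅z, t⁆ = 0
  · have hZ : ∀ z ∈ Z, ∀ l : L, ⁅z, l⁆ = 0 := by
      intro z hz l
      obtain ⟨v, hv, s, rfl⟩ := hdecomp l
      rw [lie_add, h.lie_eq_zero z hz v hv, lie_smul, hZt z hz, smul_zero, add_zero]
    have : ∃ A : Submodule k L, IsCommutative A ∧ finrank k A = finrank k Z + 2 := by
      by_cases hHZ : ∀ x ∈ H, ∀ y ∈ H, ⁅x, y⁆ ∈ Z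
      · exact h.exists_commutative_of_lie_mem hZ hlie ht hHZ (by omega)
      · exact h.exists_commutative_of_not_lie_mem hZ hlie ht hHZ
    obtain ⟨A, hA, hAf⟩ := this
    exact ⟨A, hA, by omega⟩
  -- If Z is not central, some z₀ ∈ Z pairs nontrivially with t. A multiple of z₀ corrects each
  -- kernel vector of B_ξ on H to lie in L(ξ), which makes F(L) noncommutative.
  · push Not at hZt
    obtain ⟨z₀, hz₀, hne⟩ := hZt
    refine absurd hFc (h.semiradical_not_commutative hF hne fun ξ _ hξ v hv hvk => ?_)
    refine ⟨(-(ξ ⁅v, t⁆ / ξ ⁅z₀, t⁆)) • z₀, Z.smul_mem _ hz₀, fun l => ?_⟩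
    obtain ⟨u, hu, s, rfl⟩ := hdecomp l
    simp only [lie_add, add_lie, lie_smul, smul_lie, map_add, map_smul, smul_eq_mul,
      h.lie_eq_zero z₀ hz₀ u hu, hvk u hu, map_zero]
    field_simp
    ring

end CodimensionTwo

/-! ### Large commutative ideals. -/

section CommutativeIdeal

variable {k L : Type*} [Field k] [LieRing L] [LieAlgebra k L] [FiniteDimensional k L]

/-- The bound for the image of a nilpotent representation, which consists of strictly triangular
matrices in a suitable basis. -/
lemma finrank_le_finrank_ker_toEnd (m : ℕ) : ∀ (M : Type*) [AddCommGroup M] [Module k M]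
    [LieRingModule L M] [LieModule k L M] [FiniteDimensional k M] [LieModule.IsNilpotent L M],
    finrank k M = m →
    finrank k L ≤ finrank k (LinearMap.ker (LieModule.toEnd k L M : L →ₗ[k] End k M)) +
      m.choose 2 := by
  induction m with
  | zero =>
    intro M _ _ _ _ _ _ hM
    have := finrank_zero_iff.mp hM
    have hker : LinearMap.ker (LieModule.toEnd k L M : L →ₗ[k] End k M) = ⊤ := by
      rw [eq_top_iff]
      exact fun x _ => Subsingleton.elim _ _
    rw [hker, finrank_top]
    omega
  | succ m ih =>
    intro M _ _ _ _ _ _ hM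
    have : Nontrivial M := nontrivial_of_finrank_pos (R := k) (by omega)
    have := LieModule.nontrivial_max_triv_of_isNilpotent k L M
    obtain ⟨⟨v, hv⟩, hv0⟩ := exists_ne (0 : LieModule.maxTrivSubmodule k L M)
    have hv0 : v ≠ 0 := fun h => hv0 (Subtype.ext h)
    have hvt : ∀ x : L, ⁅x, v⁆ = 0 := fun x => hv x
    let N : LieSubmodule k L M :=
      { (k ∙ v) with
        lie_mem := by
          intro x n hn
          obtain ⟨c, rfl⟩ := Submodule.mem_span_singleton.mp hn
          rw [lie_smul, hvt, smul_zero]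
          exact Submodule.zero_mem _ }
    have hQ : finrank k (M ⧸ N) = m := by
      have h1 := (k ∙ v).finrank_quotient_add_finrank
      rw [finrank_span_singleton hv0, hM] at h1
      exact Nat.succ_injective h1
    obtain ⟨d, hd⟩ := LieModule.IsNilpotent.nilpotent k L M
    have : LieModule.IsNilpotent L (M ⧸ N) :=
      (LieModule.isNilpotent_quotient_iff k L M N).mpr ⟨d, hd ▸ bot_le⟩
    have hi := ih (M ⧸ N) hQ
    set K := LinearMap.ker (LieModule.toEnd k L (M ⧸ N) : L →ₗ[k] End k (M ⧸ N)) with hK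
    have hKm : ∀ x ∈ K, ∀ n : M, ∃ c : k, c • v = ⁅x, n⁆ := by
      intro x hx n
      have h1 : LieModule.toEnd k L (M ⧸ N) x (LieSubmodule.Quotient.mk n) = 0 :=
        LinearMap.congr_fun (LinearMap.mem_ker.mp hx) _
      have h2 : ⁅x, n⁆ ∈ N := by
        rw [← LieSubmodule.Quotient.mk_eq_zero']
        exact h1
      exact Submodule.mem_span_singleton.mp h2
    obtain ⟨f, hf⟩ : ∃ f : Dual k M, f v ≠ 0 := by
      by_contra! h
      exact hv0 ((forall_dual_apply_eq_zero_iff k v).mp h)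
    -- Elements of K map M into the line of the invariant vector v and kill v. So f, nonzero at v,
    -- turns K modulo the kernel of the action into functionals on M that vanish at v, a space of
    -- dimension m.
    let g : L →ₗ[k] Dual k M :=
      (LinearMap.llcomp k M M k f) ∘ₗ (LieModule.toEnd k L M : L →ₗ[k] End k M)
    have hg : ∀ x n, g x n = f ⁅x, n⁆ := fun x n => rfl
    have hrange : LinearMap.range (g.domRestrict K) ≤ (k ∙ v).dualAnnihilator := by
      rintro _ ⟨x, rfl⟩
      rw [Submodule.mem_dualAnnihilator]
      intro w hw
      obtain ⟨c, rfl⟩ := Submodule.mem_span_singleton.mp hw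
      rw [LinearMap.domRestrict_apply, hg, lie_smul, hvt, smul_zero, map_zero]
    have hker : (LinearMap.ker (g.domRestrict K)).map K.subtype ≤
        LinearMap.ker (LieModule.toEnd k L M : L →ₗ[k] End k M) := by
      rintro _ ⟨x, hx, rfl⟩
      refine LinearMap.mem_ker.mpr (LinearMap.ext fun n => ?_)
      obtain ⟨c, hc⟩ := hKm x x.2 n
      have h1 : f ⁅(x : L), n⁆ = 0 := LinearMap.congr_fun (LinearMap.mem_ker.mp hx) n
      rw [← hc, map_smul, smul_eq_mul] at h1
      have h2 : ⁅(x : L), n⁆ = 0 := by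
        rw [← hc, (mul_eq_zero.mp h1).resolve_right hf, zero_smul]
      exact h2
    have h1 := (g.domRestrict K).finrank_range_add_finrank_ker
    have h2 := Submodule.finrank_mono hrange
    have h3 := Submodule.finrank_mono hker
    have h4 := Subspace.finrank_add_finrank_dualAnnihilator_eq (k ∙ v)
    rw [Submodule.finrank_map_subtype_eq] at h3
    rw [finrank_span_singleton hv0, hM] at h4
    have h5 : (m + 1).choose 2 = m + m.choose 2 := by
      rw [Nat.choose_succ_succ' m 1, Nat.choose_one_right]
    omega

variable (k L) in
/-- A maximal commutative ideal of a nilpotent Lie algebra is its own centralizer. -/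
theorem exists_commutative_finrank_le [LieRing.IsNilpotent L] :
    ∃ A : Submodule k L, IsCommutative A ∧
      finrank k L ≤ finrank k A + (finrank k A).choose 2 := by
  let S : Set (Submodule k L) := {A | IsCommutative A ∧ ∀ l : L, ∀ z ∈ A, ⁅l, z⁆ ∈ A}
  have hS : S.Nonempty := ⟨⊥, by
    refine ⟨?_, ?_⟩
    · rintro x hx y -
      rw [(Submodule.mem_bot k).mp hx, zero_lie]
    · rintro l z hz
      rw [(Submodule.mem_bot k).mp hz, lie_zero]
      exact Submodule.zero_mem _⟩
  obtain ⟨A, ⟨hA, hAI⟩, hmax⟩ :=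
    (wellFounded_gt : WellFounded (α := Submodule k L) (· > ·)).has_min S hS
  let C : Submodule k L :=
    { carrier := {x | ∀ a ∈ A, ⁅x, a⁆ = 0}
      add_mem' := fun {x y} hx hy a ha => by rw [add_lie, hx a ha, hy a ha, add_zero]
      zero_mem' := fun a _ => zero_lie a
      smul_mem' := fun c x hx a ha => by rw [smul_lie, hx a ha, smul_zero] }
  have hC : ∀ x, x ∈ C ↔ ∀ a ∈ A, ⁅x, a⁆ = 0 := fun x => Iff.rfl
  have hCA : C ≤ A := by
    by_contra hne
    obtain ⟨c, hc, hcA, hcl⟩ := exists_notMem_lie_mem C A (by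
      intro l z hz a ha
      rw [lie_lie, hz a ha, lie_zero, hz _ (hAI l a ha), sub_zero]) hne
    refine hmax (A ⊔ k ∙ c) ⟨hA.sup_span fun x hx => ?_, fun l z hz => ?_⟩ ?_
    · rw [← lie_skew, hc x hx, neg_zero]
    · obtain ⟨a, ha, s, rfl⟩ := mem_sup_span.mp hz
      rw [lie_add, lie_smul]
      exact Submodule.mem_sup_left (A.add_mem (hAI l a ha) (A.smul_mem s (hcl l)))
    · exact lt_of_le_of_ne le_sup_left fun h => hcA (by
        rw [h]
        exact Submodule.mem_sup_right (Submodule.mem_span_singleton_self c))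
  let A' : LieSubmodule k L L := { A with lie_mem := fun {l z} hz => hAI l z hz }
  have : LieModule.IsNilpotent L (⊤ : LieSubmodule k L L) :=
    LieModule.isNilpotent_of_top_iff'.mpr inferInstance
  have : LieModule.IsNilpotent L A' := LieModule.isNilpotent_of_le k L L A' ⊤ le_top
  have h1 := finrank_le_finrank_ker_toEnd (k := k) (L := L) (finrank k A') A' rfl
  have h2 : LinearMap.ker (LieModule.toEnd k L A' : L →ₗ[k] End k A') ≤ A := by
    intro x hx
    refine hCA ((hC x).mpr fun a ha => ?_)
    have : (LieModule.toEnd k L A' x ⟨a, ha⟩ : A') = 0 :=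
      LinearMap.congr_fun (LinearMap.mem_ker.mp hx) _
    exact congrArg Subtype.val this
  have h3 := Submodule.finrank_mono h2
  have h4 : finrank k A' = finrank k A := rfl
  exact ⟨A, hA, by rw [h4] at h1; omega⟩

end CommutativeIdeal

/-! ### A polarization larger than the semiradical forces singularity. -/

section Nonsingular

variable {k L : Type*} [Field k] [LieRing L] [LieAlgebra k L]

lemma mem_vanishingIdeal {S : Set (Dual k L)} {f : SymmetricAlgebra k L} :
    f ∈ vanishingIdeal S ↔ ∀ ξ ∈ S, evalAt ξ f = 0 := by
  simp only [vanishingIdeal, Submodule.mem_iInf, RingHom.mem_ker]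

variable [FiniteDimensional k L]

lemma exists_lie_eq_of_stabilizer_le_ker {ξ μ : Dual k L} (h : stabilizer ξ ≤ LinearMap.ker μ) :
    ∃ u : L, ∀ x : L, μ x = ξ ⁅x, u⁆ := by
  have hker : LinearMap.ker (kirillovForm ξ) = stabilizer ξ := by
    ext x
    simp [mem_stabilizer, LinearMap.ext_iff]
  have hle : LinearMap.range (kirillovForm ξ) ≤ (stabilizer ξ).dualAnnihilator := by
    rintro _ ⟨u, rfl⟩
    rw [Submodule.mem_dualAnnihilator]
    intro w hw
    rw [kirillovForm_apply, dual_lie_skew, hw u, neg_zero]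
  have h1 := (kirillovForm ξ).finrank_range_add_finrank_ker
  have h2 : finrank k (stabilizer ξ) + finrank k (stabilizer ξ).dualAnnihilator = finrank k L :=
    Subspace.finrank_add_finrank_dualAnnihilator_eq (stabilizer ξ)
  rw [hker] at h1
  have h3 : finrank k (stabilizer ξ).dualAnnihilator ≤
      finrank k (LinearMap.range (kirillovForm ξ)) := by omega
  have heq := Submodule.eq_of_le_of_finrank_le hle h3
  have hμ : μ ∈ LinearMap.range (kirillovForm ξ) := by
    rw [heq, Submodule.mem_dualAnnihilator]
    exact fun w hw => h hw
  obtain ⟨u, rfl⟩ := hμ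
  exact ⟨-u, fun x => by rw [kirillovForm_apply, lie_neg, map_neg, ← dual_lie_skew]⟩

/-- A subspace of dimension c(L) is already maximal isotropic for a regular form. -/
lemma mem_of_isotropic_of_regular {P : Submodule k L} (hP : IsCommutative P)
    (hd : 2 * finrank k P = finrank k L + index k L) {ξ : Dual k L} (hξ : ξ ∈ regularSet k L)
    {u : L} (hu : ∀ p ∈ P, ξ ⁅p, u⁆ = 0) : u ∈ P := by
  by_contra hn
  have h1 := isotropic_finrank ξ (P ⊔ k ∙ u) (by
    intro x hx y hy
    obtain ⟨a, ha, s, rfl⟩ := mem_sup_span.mp hx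
    obtain ⟨b, hb, t, rfl⟩ := mem_sup_span.mp hy
    simp [hP a ha b hb, hu a ha, dual_lie_skew ξ u b, hu b hb])
  have h2 := Submodule.finrank_mono
    (inf_le_right : (P ⊔ k ∙ u) ⊓ stabilizer ξ ≤ stabilizer ξ)
  have hξ : finrank k (stabilizer ξ) = index k L := hξ
  rw [Submodule.finrank_sup_span_singleton hn] at h1
  omega

/-- If a linear form is, up to polynomial factors, a combination of the columns of the matrix
of a commutative polarization, the set of nonregular functionals contains a hypersurface. -/
lemma codim_eq_one_of_column_relation [IsAlgClosed k] {c r : ℕ}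
    (M : Matrix (Fin c) (Fin r) (SymmetricAlgebra k L)) (a : Fin c → k) (ha : a ≠ 0)
    (hM₀ : ∀ i j, evalAt (0 : Dual k L) (M i j) = 0)
    (hreg : ∀ ξ ∈ regularSet k L, ∀ v : Fin r → k,
      (M.map (evalAt ξ)).mulVec v = 0 → v = 0)
    (hrel : ∃ q : SymmetricAlgebra k L, q ≠ 0 ∧ ∃ N : Fin r → SymmetricAlgebra k L,
      ∀ i, ∑ j, M i j * N j = q * algebraMap k _ (a i)) :
    codim (regularSet k L)ᶜ = 1 := by
  -- With q minimal for divisibility, a prime factor p of q cannot divide all N j. Where p vanishes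
  -- and some N j does not, the columns of M are dependent, so ξ is nonregular. Hence the vanishing
  -- ideal lies in (p).
  obtain ⟨q, ⟨hq, N, hN⟩, hmin⟩ := wellFounded_dvdNotUnit.has_min
    {q : SymmetricAlgebra k L | q ≠ 0 ∧ ∃ N : Fin r → SymmetricAlgebra k L,
      ∀ i, ∑ j, M i j * N j = q * algebraMap k _ (a i)} hrel
  have hqu : ¬ IsUnit q := by
    intro hu
    apply ha
    ext i
    have h1 := congrArg (evalAt (0 : Dual k L)) (hN i)
    simp only [map_sum, map_mul, hM₀, zero_mul, Finset.sum_const_zero, AlgHom.commutes] at h1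
    exact (mul_eq_zero.mp h1.symm).resolve_left (hu.map (evalAt (0 : Dual k L))).ne_zero
  obtain ⟨p, hp, q', rfl⟩ := WfDvdMonoid.exists_irreducible_factor hqu hq
  have hpp : Prime p := hp.prime
  obtain ⟨j₀, hj₀⟩ : ∃ j, ¬ p ∣ N j := by
    by_contra! hall
    choose N' hN' using hall
    have hq' : q' ≠ 0 := right_ne_zero_of_mul hq
    refine hmin q' ⟨hq', N', fun i => ?_⟩ ⟨hq', p, hp.not_isUnit, mul_comm _ _⟩
    apply mul_left_cancel₀ hpp.ne_zero
    rw [← mul_assoc, ← hN i, Finset.mul_sum]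
    refine Finset.sum_congr rfl fun j _ => ?_
    rw [hN' j]
    ring
  have hle : vanishingIdeal (regularSet k L)ᶜ ≤ Ideal.span {p} := by
    intro f hf
    rw [mem_vanishingIdeal] at hf
    rw [Ideal.mem_span_singleton]
    refine (hpp.dvd_or_dvd (dvd_of_vanishes hpp (f := f * N j₀) fun ξ hξ => ?_)).resolve_right hj₀
    rw [map_mul]
    by_cases hN0 : evalAt ξ (N j₀) = 0
    · rw [hN0, mul_zero]
    · rw [hf ξ, zero_mul]
      intro hξr
      apply hN0
      refine congrFun (hreg ξ hξr (fun j => evalAt ξ (N j)) ?_) j₀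
      ext i
      have h1 := congrArg (evalAt ξ) (hN i)
      simp only [map_sum, map_mul, hξ, zero_mul] at h1
      simpa [Matrix.mulVec, dotProduct] using h1
  have hne : vanishingIdeal (regularSet k L)ᶜ ≠ ⊥ := by
    obtain ⟨f, hf, hfr⟩ := exists_generic_polynomial k L
    refine (Submodule.ne_bot_iff _).mpr ⟨f, mem_vanishingIdeal.mpr fun ξ hξ => ?_, hf⟩
    by_contra h
    exact hξ (hfr ξ h)
  have hprime : (Ideal.span {p}).IsPrime := (Ideal.span_singleton_prime hpp.ne_zero).mpr hpp
  apply le_antisymm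
  · refine (Ideal.height_mono hle).trans
      (Ideal.height_le_one_of_isPrincipal_of_mem_minimalPrimes (Ideal.span {p}) _ ?_)
    rw [Ideal.minimalPrimes_eq_subsingleton_self]
    rfl
  · rw [Order.one_le_iff_ne_zero]
    exact fun h => hne (Ideal.height_eq_zero_iff_eq_bot.mp h)

/-- In the nonsingular case a commutative polarization is the semiradical. -/
theorem semiradical_eq_of_isNonsingular [IsAlgClosed k] {P : Submodule k L}
    (hP : IsCommutative P) (hd : 2 * finrank k P = finrank k L + index k L)
    (hns : IsNonsingular k L) : frobeniusSemiradical k L = P := by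
  have hle := semiradical_le_of_finrank P hP hd
  by_contra hne
  apply hns
  obtain ⟨u, huP, hu⟩ := SetLike.exists_of_lt (lt_of_le_of_ne hle hne)
  obtain ⟨μ, hμu, hμ⟩ := Submodule.exists_le_ker_of_notMem hu
  obtain ⟨C, hC⟩ := P.exists_isCompl
  let b := finBasis k P
  let y := finBasis k C
  let M : Matrix (Fin (finrank k P)) (Fin (finrank k C)) (SymmetricAlgebra k L) :=
    Matrix.of fun i j => coord (k := k) ⁅(b i : L), (y j : L)⁆
  have hM : ∀ ξ : Dual k L, M.map (evalAt ξ) = Matrix.of fun i j => ξ ⁅(b i : L), (y j : L)⁆ := by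
    intro ξ
    ext i j
    simp [M]
  have hreg : ∀ ξ ∈ regularSet k L, ∀ v : Fin (finrank k C) → k,
      (M.map (evalAt ξ)).mulVec v = 0 → v = 0 := by
    intro ξ hξ v hv
    rw [hM] at hv
    let w : C := ∑ j, v j • y j
    have hw : (w : L) ∈ P := mem_of_isotropic_of_regular hP hd hξ (by
      have : ((kirillovForm ξ).flip (w : L)) ∘ₗ P.subtype = 0 := by
        refine b.ext fun i => ?_
        have := congrFun hv i
        simpa [Matrix.mulVec, dotProduct, w, lie_sum, mul_comm] using this
      intro p hp
      simpa using LinearMap.congr_fun this ⟨p, hp⟩)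
    have hw0 : w = 0 := by
      exact_mod_cast (Submodule.disjoint_def.mp hC.disjoint) w hw w.2
    have := y.linearIndependent
    rw [Fintype.linearIndependent_iff] at this
    exact funext fun j => this v hw0 j
  -- Since μ kills L(ξ), it equals ξ[·,w] for some w. On P only the component of w in C matters.
  have hcol : ∀ ξ ∈ regularSet k L, ∃ v : Fin (finrank k C) → k,
      (M.map (evalAt ξ)).mulVec v = fun i => μ (b i) := by
    intro ξ hξ
    obtain ⟨w, hw⟩ := exists_lie_eq_of_stabilizer_le_ker ((stabilizer_le_semiradical hξ).trans
      (le_sup_left.trans (sup_le hμ le_rfl)) : stabilizer ξ ≤ LinearMap.ker μ)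
    obtain ⟨p, hp, d, hdC, rfl⟩ := Submodule.mem_sup.mp
      (show w ∈ P ⊔ C by rw [hC.sup_eq_top]; trivial)
    refine ⟨fun j => y.repr ⟨d, hdC⟩ j, funext fun i => ?_⟩
    have h1 : d = ∑ j, y.repr ⟨d, hdC⟩ j • (y j : L) := by
      have := congrArg C.subtype (y.sum_repr ⟨d, hdC⟩)
      rw [map_sum] at this
      exact this.symm
    rw [hw, lie_add, hP _ (b i).2 p hp, zero_add, hM]
    conv_rhs => rw [h1]
    simp [Matrix.mulVec, dotProduct, lie_sum, mul_comm]
  obtain ⟨ξ₀, hξ₀⟩ := regularSet_nonempty k L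
  obtain ⟨G, hG⟩ : ∃ G : Matrix (Fin (finrank k C)) (Fin (finrank k P)) k,
      G * M.map (evalAt ξ₀) = 1 := by
    obtain ⟨g, hg⟩ := LinearMap.exists_leftInverse_of_injective
      (Matrix.toLin' (M.map (evalAt ξ₀))) (LinearMap.ker_eq_bot'.mpr fun v hv =>
        hreg ξ₀ hξ₀ v (by rwa [Matrix.toLin'_apply] at hv))
    refine ⟨LinearMap.toMatrix' g, ?_⟩
    rw [← LinearMap.toMatrix'_toLin' (M.map (evalAt ξ₀)), ← LinearMap.toMatrix'_comp, hg,
      LinearMap.toMatrix'_id]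
  let a : Fin (finrank k P) → k := fun i => μ (b i)
  have ha : a ≠ 0 := by
    intro h0
    apply hμu
    have : μ ∘ₗ P.subtype = 0 := b.ext fun i => congrFun h0 i
    exact LinearMap.congr_fun this ⟨u, huP⟩
  let A := algebraMap k (SymmetricAlgebra k L)
  let D := G.map A * M
  have hGe : ∀ ξ : Dual k L, (G.map A).map (evalAt ξ) = G := by
    intro ξ
    ext i j
    simp [A]
  have hD : ∀ ξ : Dual k L, D.map (evalAt ξ) = G * M.map (evalAt ξ) := by
    intro ξ
    simp only [D, Matrix.map_mul, hGe]
  have hdet : ∀ ξ : Dual k L, evalAt ξ D.det = (G * M.map (evalAt ξ)).det := by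
    intro ξ
    rw [← hD, AlgHom.map_det]
    rfl
  -- Cramer's rule makes the pointwise solutions polynomial: with D = GM invertible at ξ₀, N =
  -- adj(D)Ga satisfies MN = det(D)a at regular ξ, hence identically.
  refine codim_eq_one_of_column_relation M a ha (fun i j => by simp [M]) hreg
    ⟨D.det, ?_, D.adjugate.mulVec ((G.map A).mulVec fun i => A (a i)), fun i => ?_⟩
  · intro h0
    have := hdet ξ₀
    rw [h0, map_zero, hG, Matrix.det_one] at this
    exact zero_ne_one this
  · rw [← sub_eq_zero]
    refine eq_zero_of_forall_regular fun ξ hξ => ?_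
    obtain ⟨v, hv⟩ := hcol ξ hξ
    have h1 : ∀ j, evalAt ξ (D.adjugate.mulVec ((G.map A).mulVec fun i => A (a i)) j) =
        ((G * M.map (evalAt ξ)).adjugate.mulVec (G.mulVec a)) j := by
      intro j
      have e1 : (G * M.map (evalAt ξ)).adjugate = D.adjugate.map (evalAt ξ) := by
        rw [← hD]
        exact ((evalAt ξ).map_adjugate D).symm
      rw [e1]
      simp [Matrix.mulVec, dotProduct, A]
    have h2 : G.mulVec a = (G * M.map (evalAt ξ)).mulVec v := by
      rw [← Matrix.mulVec_mulVec, hv]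
    have h3 : (G * M.map (evalAt ξ)).adjugate.mulVec (G.mulVec a) =
        (G * M.map (evalAt ξ)).det • v := by
      rw [h2, Matrix.mulVec_mulVec, Matrix.adjugate_mul, Matrix.smul_mulVec, Matrix.one_mulVec]
    have h4 := congrFun hv i
    simp only [map_sub, map_sum, map_mul, h1, h3, hdet, AlgHom.commutes, Pi.smul_apply, smul_eq_mul]
    rw [sub_eq_zero]
    simp only [Matrix.mulVec, dotProduct, Matrix.map_apply] at h4
    show _ = _ * μ (b i)
    rw [← h4, Finset.mul_sum]
    exact Finset.sum_congr rfl fun j _ => by ring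

end Nonsingular

/-! ### Dimension counts and the cases of the theorem. -/

section Main

variable {k L : Type*} [Field k] [LieRing L] [LieAlgebra k L]

/-- A commutative subspace as a subalgebra. -/
def IsCommutative.toLieSubalgebra {A : Submodule k L} (hA : IsCommutative A) :
    LieSubalgebra k L :=
  { A with lie_mem' := fun {x y} hx hy => by rw [hA x hx y hy]; exact A.zero_mem }

lemma IsCommutative.isLieAbelian {A : Submodule k L} (hA : IsCommutative A) :
    IsLieAbelian hA.toLieSubalgebra :=
  ⟨fun x y => Subtype.ext (hA x x.2 y y.2)⟩

lemma isCommutative_of_isLieAbelian (A : LieSubalgebra k L) (hA : IsLieAbelian A) :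
    IsCommutative A.toSubmodule := fun x hx y hy =>
  congrArg Subtype.val (hA.trivial ⟨x, hx⟩ ⟨y, hy⟩)

lemma IsCommutative.finrank_toLieSubalgebra {A : Submodule k L} (hA : IsCommutative A) :
    finrank k hA.toLieSubalgebra = finrank k A := rfl

lemma eq_magicNumber_iff {d : ℕ} :
    (d : ℚ) = magicNumber k L ↔ 2 * d = finrank k L + index k L := by
  rw [magicNumber, eq_div_iff two_ne_zero]
  constructor
  · intro h
    have : ((d * 2 : ℕ) : ℚ) = ((finrank k L + index k L : ℕ) : ℚ) := by push_cast; exact h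
    have := Nat.cast_injective this
    omega
  · intro h
    have : ((2 * d : ℕ) : ℚ) = ((finrank k L + index k L : ℕ) : ℚ) := by rw [h]
    push_cast at this
    linarith

lemma eq_magicNumber_sub_one_iff {d : ℕ} :
    (d : ℚ) = magicNumber k L - 1 ↔ 2 * d + 2 = finrank k L + index k L := by
  have h := eq_magicNumber_iff (k := k) (L := L) (d := d + 1)
  push_cast at h
  rw [eq_sub_iff_add_eq, h]
  omega

lemma maxAbelianDim_eq {A : Submodule k L} (hA : IsCommutative A)
    (hmax : ∀ B : Submodule k L, IsCommutative B → finrank k B ≤ finrank k A) :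
    maxAbelianDim k L = finrank k A := by
  refine IsGreatest.csSup_eq ⟨⟨hA.toLieSubalgebra, hA.isLieAbelian, rfl⟩, ?_⟩
  rintro _ ⟨B, hB, rfl⟩
  exact hmax B.toSubmodule (isCommutative_of_isLieAbelian B hB)

variable [FiniteDimensional k L]

/-- The sum dim L + i(L) is even, so only dim A = c(L) and dim A = c(L) - 1 are left. -/
lemma rProperty_of_le [CharZero k] {A : Submodule k L} (hA : IsCommutative A)
    (h : finrank k L + index k L ≤ 2 * finrank k A + 2) : RProperty k L := by
  have h1 := isotropic_finrank_le A hA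
  obtain ⟨r, hr⟩ := exists_finrank_eq_index_add k L
  by_cases h2 : 2 * finrank k A = finrank k L + index k L
  · exact Or.inl ⟨hA.toLieSubalgebra, hA.isLieAbelian, eq_magicNumber_iff.mpr h2⟩
  · exact Or.inr ⟨hA.toLieSubalgebra, hA.isLieAbelian,
      eq_magicNumber_sub_one_iff.mpr (by rw [hA.finrank_toLieSubalgebra]; omega)⟩

variable (k L) in
lemma index_pos [LieRing.IsNilpotent L] (h : 0 < finrank k L) : 0 < index k L := by
  have : Nontrivial L := nontrivial_of_finrank_pos h
  have := LieModule.nontrivial_max_triv_of_isNilpotent k L L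
  obtain ⟨⟨z, hz⟩, hz0⟩ := exists_ne (0 : LieModule.maxTrivSubmodule k L L)
  obtain ⟨ξ, hξ⟩ := regularSet_nonempty k L
  have hξ : finrank k (stabilizer ξ) = index k L := hξ
  have hmem : z ∈ stabilizer ξ := mem_stabilizer_of_forall_lie (fun y => by
    rw [← lie_skew, hz y, neg_zero]) ξ
  rw [← hξ, finrank_pos_iff]
  exact ⟨⟨z, hmem⟩, 0, fun h0 => hz0 (Subtype.ext (Subtype.ext_iff.mp h0 : z = 0))⟩

lemma isCommutative_top_of_finrank_le_index (h : finrank k L ≤ index k L) :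
    IsCommutative (⊤ : Submodule k L) := by
  intro x _ y _
  refine (forall_dual_apply_eq_zero_iff k _).mp fun ξ => ?_
  have h1 : stabilizer ξ = ⊤ := Submodule.eq_top_of_finrank_eq
    (le_antisymm (Submodule.finrank_le _) (h.trans (index_le ξ)))
  have hx : x ∈ stabilizer ξ := h1 ▸ Submodule.mem_top
  exact hx y

lemma pfaffian_eq_zero_of_finrank_le (h : finrank k L ≤ index k L + 2) (ξ : Dual k L)
    (x y z w : L) : pfaffian ξ x y z w = 0 := by
  by_contra hne
  have h1 := add_finrank_stabilizer_le_of_pfaffian (le_top : stabilizer ξ ≤ ⊤)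
    (x := x) (y := y) (z := z) (w := w) trivial trivial trivial trivial hne
  have h2 := index_le ξ
  rw [finrank_top] at h1
  omega

/-- If the semiradical lies in a hyperplane, the forms have smaller rank on this hyperplane. -/
lemma pfaffian_eq_zero_of_semiradical_le [Infinite k] (hL : finrank k L = index k L + 4)
    {H : Submodule k L} (hF : frobeniusSemiradical k L ≤ H) (hH : finrank k H + 1 = finrank k L)
    (ξ : Dual k L) (x : L) (hx : x ∈ H) (y : L) (hy : y ∈ H) (z : L) (hz : z ∈ H)
    (w : L) (hw : w ∈ H) : pfaffian ξ x y z w = 0 := by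
  let c : L →ₗ[k] SymmetricAlgebra k L := coord
  have hev : ∀ η : Dual k L, evalAt η (c ⁅x, y⁆ * c ⁅z, w⁆ - c ⁅x, z⁆ * c ⁅y, w⁆ +
      c ⁅x, w⁆ * c ⁅y, z⁆) = pfaffian η x y z w := by
    intro η
    simp [c, pfaffian]
  suffices h0 : c ⁅x, y⁆ * c ⁅z, w⁆ - c ⁅x, z⁆ * c ⁅y, w⁆ + c ⁅x, w⁆ * c ⁅y, z⁆ = 0 by
    rw [← hev, h0, map_zero]
  refine eq_zero_of_forall_regular fun η hη => ?_
  rw [hev]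
  by_contra hne
  have h1 := add_finrank_stabilizer_le_of_pfaffian ((stabilizer_le_semiradical hη).trans hF)
    hx hy hz hw hne
  have hη : finrank k (stabilizer η) = index k L := hη
  omega

lemma exists_commutative_of_finrank_le_add_two (h : finrank k L ≤ index k L + 2) :
    ∃ A : Submodule k L, IsCommutative A ∧ finrank k L ≤ finrank k A + 2 := by
  obtain ⟨A, -, hA, hf⟩ := exists_commutative_codim_two (⊤ : Submodule k L)
    fun ξ x _ y _ z _ w _ => pfaffian_eq_zero_of_finrank_le h ξ x y z w
  rw [finrank_top] at hf
  exact ⟨A, hA, hf⟩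

/-- For V = L the kernels of the forms are the stabilizers themselves, so the free case contradicts
commutativity of F(L) without any correction by Z. -/
lemma exists_commutative_hyperplane [Infinite k] (h : finrank k L ≤ index k L + 2)
    (hF : IsCommutative (frobeniusSemiradical k L)) :
    ∃ A : Submodule k L, IsCommutative A ∧ finrank k L ≤ finrank k A + 1 := by
  rcases exists_commutative_or_isFreeMod (⊤ : Submodule k L)
    (fun ξ x _ y _ z _ w _ => pfaffian_eq_zero_of_finrank_le h ξ x y z w) with
    ⟨A, -, hA, hf⟩ | ⟨Z, hZ⟩
  · rw [finrank_top] at hf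
    exact ⟨A, hA, hf⟩
  · obtain ⟨_, -, _, -, z, -, hi⟩ := hZ.exists_basis
    have hz : z ≠ 0 := fun h0 => hi.notMem.1 (h0 ▸ Z.zero_mem)
    refine absurd hF (hZ.semiradical_not_commutative le_top hz fun ξ _ _ v _ hv =>
      ⟨0, Z.zero_mem, ?_⟩)
    rw [add_zero]
    exact fun y => hv y trivial

variable (k L) in
lemma exists_commutative_three_le [LieRing.IsNilpotent L] (h : 4 ≤ finrank k L) :
    ∃ A : Submodule k L, IsCommutative A ∧ 3 ≤ finrank k A := by
  obtain ⟨A, hA, hf⟩ := exists_commutative_finrank_le k L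
  refine ⟨A, hA, ?_⟩
  by_contra! hlt
  have : (finrank k A).choose 2 ≤ Nat.choose 2 2 := Nat.choose_le_choose 2 (by omega)
  simp at this
  omega

variable (k L) in
lemma exists_commutative_four_le [LieRing.IsNilpotent L] (h : 7 ≤ finrank k L) :
    ∃ A : Submodule k L, IsCommutative A ∧ 4 ≤ finrank k A := by
  obtain ⟨A, hA, hf⟩ := exists_commutative_finrank_le k L
  refine ⟨A, hA, ?_⟩
  by_contra! hlt
  have : (finrank k A).choose 2 ≤ Nat.choose 3 2 := Nat.choose_le_choose 2 (by omega)
  rw [show Nat.choose 3 2 = 3 from rfl] at this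
  omega

variable [CharZero k] [LieRing.IsNilpotent L]

variable (k L) in
/-- In dimension at most seven there is a commutative subspace of dimension at least
`c(L) - 1`. -/
theorem exists_commutative_of_finrank_le_seven (hn : finrank k L ≤ 7) :
    ∃ A : Submodule k L, IsCommutative A ∧
      finrank k L + index k L ≤ 2 * finrank k A + 2 := by
  obtain ⟨r, hr⟩ := exists_finrank_eq_index_add k L
  have hpos := index_pos k L
  -- Here c(L) = n - r. For r = 2, n ≤ 6 dimension 3 suffices, and for r ≥ 2, n = 7 dimension 4.
  rcases (by omega : r = 0 ∨ r = 1 ∨ (r = 2 ∧ 4 ≤ finrank k L ∧ finrank k L ≤ 6) ∨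
    (2 ≤ r ∧ 7 ≤ finrank k L)) with h | h | h | h
  · refine ⟨⊤, isCommutative_top_of_finrank_le_index (by omega), ?_⟩
    rw [finrank_top]
    omega
  · obtain ⟨A, hA, hf⟩ := exists_commutative_of_finrank_le_add_two (k := k) (L := L) (by omega)
    exact ⟨A, hA, by omega⟩
  · obtain ⟨A, hA, hf⟩ := exists_commutative_three_le k L h.2.1
    exact ⟨A, hA, by omega⟩
  · obtain ⟨A, hA, hf⟩ := exists_commutative_four_le k L h.2
    exact ⟨A, hA, by omega⟩

/-- In dimension at most seven a commutative semiradical forces a commutative polarization. -/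
theorem exists_commutative_of_semiradical [IsAlgClosed k] (hn : finrank k L ≤ 7)
    (hF : IsCommutative (frobeniusSemiradical k L)) :
    ∃ A : Submodule k L, IsCommutative A ∧ finrank k L + index k L ≤ 2 * finrank k A := by
  obtain ⟨r, hr⟩ := exists_finrank_eq_index_add k L
  have hpos := index_pos k L
  rcases (by omega : r = 0 ∨ r = 1 ∨ r = 2 ∨ 7 ≤ finrank k L ∧ r = 3) with h | h | h | h
  · refine ⟨⊤, isCommutative_top_of_finrank_le_index (by omega), ?_⟩
    rw [finrank_top]
    omega
  · obtain ⟨A, hA, hf⟩ := exists_commutative_hyperplane (by omega) hF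
    exact ⟨A, hA, by omega⟩
  · by_cases hT : frobeniusSemiradical k L = ⊤
    · refine ⟨⊤, hT ▸ hF, ?_⟩
      rw [finrank_top]
      omega
    · obtain ⟨H, hFH, hH, hlie⟩ := exists_hyperplane _ hT fun x hx y hy => by
        rw [hF x hx y hy]
        exact Submodule.zero_mem _
      obtain ⟨A, hA, hf⟩ := exists_commutative_of_hyperplane hn H hH hlie hFH hF
        (pfaffian_eq_zero_of_semiradical_le (by omega) hFH hH)
      exact ⟨A, hA, by omega⟩
  -- Here n = 7 and i(L) = 1, so c(L) = 4.
  · obtain ⟨A, hA, hf⟩ := exists_commutative_four_le k L h.1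
    exact ⟨A, hA, by omega⟩

theorem exists_commutative_of_finrank_eq_eight (hn : finrank k L = 8)
    (h : index k L = 4 → ¬ QuasiQuadratic k L) :
    ∃ A : Submodule k L, IsCommutative A ∧
      finrank k L + index k L ≤ 2 * finrank k A + 2 := by
  obtain ⟨r, hr⟩ := exists_finrank_eq_index_add k L
  have hpos := index_pos k L
  rcases (by omega : r = 0 ∨ r = 1 ∨ index k L = 4 ∨ r = 3) with h | h | h4 | h
  · refine ⟨⊤, isCommutative_top_of_finrank_le_index (by omega), ?_⟩
    rw [finrank_top]
    omega
  · obtain ⟨A, hA, hf⟩ := exists_commutative_of_finrank_le_add_two (k := k) (L := L) (by omega)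
    exact ⟨A, hA, by omega⟩
  -- Here c(L) = 6, and codimension two in a hyperplane containing F(L) gives dimension 5.
  · obtain ⟨f, hf, hle⟩ := Submodule.exists_le_ker_of_lt_top _ (lt_top_iff_ne_top.mpr (h h4))
    have hH := Module.Dual.finrank_ker_add_one_of_ne_zero hf
    obtain ⟨A, -, hA, hf⟩ := exists_commutative_codim_two (LinearMap.ker f)
      (pfaffian_eq_zero_of_semiradical_le (by omega) hle hH)
    exact ⟨A, hA, by omega⟩
  · obtain ⟨A, hA, hf⟩ := exists_commutative_four_le k L (by omega)
    exact ⟨A, hA, by omega⟩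

end Main

end RentschlerProperty

theorem theorem6p2 {k L : Type*} [Field k] [IsAlgClosed k] [CharZero k]
    [LieRing L] [LieAlgebra k L] [FiniteDimensional k L] [LieRing.IsNilpotent L] :
    (Module.finrank k L ≤ 7 →
      RentschlerProperty.RProperty k L ∧
      (RentschlerProperty.SemiradicalAbelian k L →
        (RentschlerProperty.maxAbelianDim k L : ℚ) = RentschlerProperty.magicNumber k L ∧
        (RentschlerProperty.IsNonsingular k L →
          ∃ P : LieSubalgebra k L,
            P.toSubmodule = RentschlerProperty.frobeniusSemiradical k L ∧
            RentschlerProperty.IsCP P ∧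
            ∀ Q : LieSubalgebra k L, RentschlerProperty.IsCP Q → Q = P)) ∧
      (¬ RentschlerProperty.SemiradicalAbelian k L →
        (RentschlerProperty.maxAbelianDim k L : ℚ) =
          RentschlerProperty.magicNumber k L - 1)) ∧
    (Module.finrank k L = 8 →
      (RentschlerProperty.index k L ≠ 4 ∨
        (RentschlerProperty.index k L = 4 ∧ ¬ RentschlerProperty.QuasiQuadratic k L)) →
      RentschlerProperty.RProperty k L) := by
  open RentschlerProperty in
  refine ⟨fun hn => ⟨?_, fun hF => ?_, fun hF => ?_⟩, fun hn h => ?_⟩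
  · obtain ⟨A, hA, hf⟩ := exists_commutative_of_finrank_le_seven k L hn
    exact rProperty_of_le hA hf
  · obtain ⟨A, hA, hf⟩ := exists_commutative_of_semiradical hn hF
    have hd := le_antisymm (isotropic_finrank_le A hA) hf
    refine ⟨?_, fun hns => ⟨hA.toLieSubalgebra,
      (semiradical_eq_of_isNonsingular hA hd hns).symm,
      ⟨hA.isLieAbelian, eq_magicNumber_iff.mpr hd⟩, fun Q hQ => ?_⟩⟩
    · rw [maxAbelianDim_eq hA fun B hB => by
        have := isotropic_finrank_le B hB
        omega]
      exact eq_magicNumber_iff.mpr hd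
    · apply LieSubalgebra.toSubmodule_injective
      rw [← semiradical_eq_of_isNonsingular (isCommutative_of_isLieAbelian Q hQ.1)
        (eq_magicNumber_iff.mp hQ.2) hns]
      exact semiradical_eq_of_isNonsingular hA hd hns
  · obtain ⟨A, hA, hf⟩ := exists_commutative_of_finrank_le_seven k L hn
    have hlt : ∀ B : Submodule k L, IsCommutative B →
        2 * Module.finrank k B < Module.finrank k L + index k L := by
      intro B hB
      refine lt_of_le_of_ne (isotropic_finrank_le B hB) fun h => hF ?_
      have hle := semiradical_le_of_finrank B hB h
      exact fun x hx y hy => hB x (hle hx) y (hle hy)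
    obtain ⟨r, hr⟩ := exists_finrank_eq_index_add k L
    have hA' := hlt A hA
    rw [maxAbelianDim_eq hA fun B hB => by
      have := hlt B hB
      omega]
    exact eq_magicNumber_sub_one_iff.mpr (by omega)
  · obtain ⟨A, hA, hf⟩ := exists_commutative_of_finrank_eq_eight hn fun h4 => by
      rcases h with h | h
      · exact absurd h4 h
      · exact h.2
    exact rProperty_of_le hA hf
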